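/- Let $q\ge1$, $\lambda>0$, $0<\theta<1$, and for $i=1,\dots,q$ let $a_i>0$ and let $\lambda_{i1},\dots,\lambda_{ik_i}>0$; put $\lambda_i=\lambda_{i1}+\dots+\lambda_{ik_i}$. On a probability space let: - $M_1,\dots,M_q$ be independent generalized counting processes (GCPs), that is, Lévy processes with values in $\mathbb N_0$ such that $\Pr\{M_i(t)=n\}=\sum_{\Omega(k_i,n)}\prod_{j=1}^{k_i}\frac{(\lambda_{ij}t)^{n_j}}{n_j!}e^{-\lambda_{ij}t}$, where $\Omega(k,n)=\{(n_1,\dots,n_k)\in\mathbb N_0^k:\sum_{j=1}^k jn_j=n\}$; - $Z_1,\dots,Z_q$ be independent gamma Lévy processes, $Z_i(t)$ having the gamma distribution with shape $\lambda t$ and rate $a_i$ for $t>0$; - $B^-$ be a negative binomial Lévy process, $\Pr\{B^-(t)=n\}=(1-\theta)^t\binom{n+t-1}{n}\theta^n$, $n\in\mathbb N_0$, independent of $(Z_1,\dots,Z_q)$. Put $G_i(t)=Z_i(t+\lambda^{-1}B^-(\lambda t))$, and suppose that $(M_1,\dots,M_q)$ is independent of $(Z_1,\dots,Z_q)$ and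 of $(G_1,\dots,G_q)$. Consider the processes in $\mathbb R^q$ $$\bar M(\bar Z(t))=(M_1(Z_1(t)),\dots,M_q(Z_q(t))),\qquad \bar{\mathscr M}(t)=(M_1(G_1(t)),\dots,M_q(G_q(t))),\qquad t\ge0.$$ **Theorem.** Both are Lévy processes, and each has exactly one Lévy measure in the sense of the Lévy–Khintchine formula. For a tuple $(n_{i1},\dots,n_{ik_i})\in\Omega(k_i,n_i)$ write $\eta_i=n_{i1}+\dots+n_{ik_i}$, and let $(x)_m=x(x+1)\cdots(x+m-1)$, $(x)_0=1$. For all Borel sets $A_1,\dots,A_q\subseteq\mathbb R$, the Lévy measure of $\bar M(\bar Z(t))$ is $$\Pi_{\bar M(\bar Z(t))}(A_1\times\dots\times A_q)=\lambda\sum_{i=1}^{q}\sum_{n_i=1}^{\infty}\ \sum_{\Omega(k_i,n_i)}\Gamma(\eta_i)\,\mathbb I_{\{n_i\in A_i\}}\Big(\prod_{j\ne i}\mathbb I_{\{0\in A_j\}}\Big)\prod_{l=1}^{k_i}\Big(\frac{\lambda_{il}}{a_i+\lambda_i}\Big)^{n_{il}}\frac1{n_{il}!},$$ which is concentrated on the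 coordinate axes, and the Lévy measure of $\bar{\mathscr M}(t)$ is $$\Pi_{\bar{\mathscr M}(t)}(A_1\times\dots\times A_q)=\Pi_{\bar M(\bar Z(t))}(A_1\times\dots\times A_q)+\lambda\sum_{\bar n\in\mathbb N_0^q,\ \bar n\ne\bar 0}\ \sum_{k=1}^{\infty}\frac{\theta^k}{k}\prod_{i=1}^{q}\Big(\frac{a_i}{a_i+\lambda_i}\Big)^{k}\,\mathbb I_{\{n_i\in A_i\}}\sum_{\Omega(k_i,n_i)}(k)_{\eta_i}\prod_{l=1}^{k_i}\Big(\frac{\lambda_{il}}{a_i+\lambda_i}\Big)^{n_{il}}\frac1{n_{il}!}.$$ -/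

import Mathlib

open MeasureTheory ProbabilityTheory Filter Topology
open scoped NNReal ENNReal Nat

noncomputable section

/-- A Lévy process: it starts at `0`, has independent and stationary increments, and almost all of
its paths are right-continuous with left limits (stochastic continuity follows from these). -/
structure IsLevyProcess {Ω E : Type*} [MeasurableSpace Ω] [NormedAddCommGroup E]
    [MeasurableSpace E] (P : Measure Ω) (X : ℝ≥0 → Ω → E) : Prop where
  aemeasurable : ∀ t, AEMeasurable (X t) P
  zero : ∀ᵐ ω ∂P, X 0 ω = 0
  indep : HasIndepIncrements X P
  stationary : ∀ s t, IdentDistrib (fun ω => X (s + t) ω - X s ω) (X t) P P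
  cadlag : ∀ᵐ ω ∂P, ∀ t, ContinuousWithinAt (fun s => X s ω) (Set.Ici t) t ∧
    ∃ l, Tendsto (fun s => X s ω) (𝓝[<] t) (𝓝 l)

/-- The exponent in the Lévy–Khintchine formula on `ℝ^q`, with drift `b`, Gaussian covariance
matrix `S` and jump measure `ν` (truncation on the open unit ball). -/
def levyExponent {q : ℕ} (b : EuclideanSpace ℝ (Fin q)) (S : Matrix (Fin q) (Fin q) ℝ)
    (ν : Measure (EuclideanSpace ℝ (Fin q))) (u : EuclideanSpace ℝ (Fin q)) : ℂ :=
  Complex.I * (inner ℝ b u : ℝ) - ((dotProduct u.ofLp (S.mulVec u.ofLp) / 2 : ℝ) : ℂ)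
    + ∫ x, (Complex.exp (Complex.I * (inner ℝ x u : ℝ)) - 1
        - Complex.I * (Set.indicator {y | ‖y‖ < 1} (fun y => inner ℝ y u) x : ℝ)) ∂ν

/-- `X` is a Lévy process on `ℝ^q` and `ν` is the measure that appears in the Lévy–Khintchine
formula for its characteristic function. -/
structure IsLevyMeasure {Ω : Type*} [MeasurableSpace Ω] (P : Measure Ω) {q : ℕ}
    (X : ℝ≥0 → Ω → EuclideanSpace ℝ (Fin q)) (ν : Measure (EuclideanSpace ℝ (Fin q))) :
    Prop where
  isLevyProcess : IsLevyProcess P X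
  zero : ν {0} = 0
  lintegral_lt_top : ∫⁻ x, ENNReal.ofReal (min 1 (‖x‖ ^ 2)) ∂ν < ∞
  charFun_eq : ∃ (b : EuclideanSpace ℝ (Fin q)) (S : Matrix (Fin q) (Fin q) ℝ),
    S.PosSemidef ∧ ∀ (t : ℝ≥0) (u : EuclideanSpace ℝ (Fin q)),
      charFun (P.map (X t)) u = Complex.exp ((t : ℝ) * levyExponent b S ν u)

/-- `Ω(k, n)`: the tuples `(n_1, …, n_k)` of non-negative integers with `∑ j * n_j = n`. -/
def omegaSet (k n : ℕ) : Finset (Fin k → ℕ) :=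
  (Fintype.piFinset fun _ => Finset.range (n + 1)).filter
    fun f => ∑ j : Fin k, ((j : ℕ) + 1) * f j = n

theorem mem_omegaSet {k n : ℕ} {f : Fin k → ℕ} :
    f ∈ omegaSet k n ↔ ∑ j : Fin k, ((j : ℕ) + 1) * f j = n := by
  simp only [omegaSet, Finset.mem_filter, Fintype.mem_piFinset, Finset.mem_range,
    and_iff_right_iff_imp]
  intro h j
  have h1 : ((j : ℕ) + 1) * f j ≤ ∑ j : Fin k, ((j : ℕ) + 1) * f j :=
    Finset.single_le_sum (f := fun j : Fin k => ((j : ℕ) + 1) * f j)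
      (fun _ _ => Nat.zero_le _) (Finset.mem_univ j)
  nlinarith [Nat.zero_le ((j : ℕ) * f j)]

/-- A generalized counting process with jumps of sizes `1, …, k` at rates `r 0, …, r (k - 1)`. -/
structure IsGCP {Ω : Type*} [MeasurableSpace Ω] (P : Measure Ω) {k : ℕ} (r : Fin k → ℝ)
    (N : ℝ≥0 → Ω → ℕ) : Prop where
  measurable : ∀ t, Measurable (N t)
  isLevyProcess : IsLevyProcess P (fun t ω => (N t ω : ℝ))
  pmf : ∀ (t : ℝ≥0) (n : ℕ), P.real {ω | N t ω = n} =
    ∑ f ∈ omegaSet k n, ∏ j, (r j * t) ^ f j / (f j)! * Real.exp (-(r j * t))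

/-- A gamma process: a Lévy process whose value at `t > 0` has the gamma distribution with shape
parameter `lam * t` and rate parameter `a`. -/
structure IsGammaProcess {Ω : Type*} [MeasurableSpace Ω] (P : Measure Ω) (lam : ℝ≥0) (a : ℝ)
    (Z : ℝ≥0 → Ω → ℝ≥0) : Prop where
  measurable : ∀ t, Measurable (Z t)
  isLevyProcess : IsLevyProcess P (fun t ω => (Z t ω : ℝ))
  law : ∀ t : ℝ≥0, 0 < t →
    P.map (fun ω => (Z t ω : ℝ)) = gammaMeasure ((lam : ℝ) * t) a

/-- A negative binomial process with parameter `θ`; the binomial coefficient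
`(n + t - 1 choose n)` with real upper entry is `t (t + 1) ⋯ (t + n - 1) / n!`. -/
structure IsNegBinProcess {Ω : Type*} [MeasurableSpace Ω] (P : Measure Ω) (θ : ℝ)
    (B : ℝ≥0 → Ω → ℕ) : Prop where
  measurable : ∀ t, Measurable (B t)
  isLevyProcess : IsLevyProcess P (fun t ω => (B t ω : ℝ))
  pmf : ∀ (t : ℝ≥0) (n : ℕ), P.real {ω | B t ω = n} =
    (1 - θ) ^ (t : ℝ) * ((ascPochhammer ℝ n).eval (t : ℝ) / n !) * θ ^ n

/-- The components `G_i(t) = Z_i(t + B(lam t) / lam)` of the multivariate gamma subordinator. -/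
def gammaSubordinator {Ω : Type*} {q : ℕ} (lam : ℝ≥0) (Z : Fin q → ℝ≥0 → Ω → ℝ≥0)
    (B : ℝ≥0 → Ω → ℕ) (i : Fin q) (t : ℝ≥0) (ω : Ω) : ℝ≥0 :=
  Z i (t + lam⁻¹ * (B (lam * t) ω : ℝ≥0)) ω

/-- The process `(M_1(T_1(t)), …, M_q(T_q(t)))` in `ℝ^q`. -/
def timeChange {Ω : Type*} {q : ℕ} (M : Fin q → ℝ≥0 → Ω → ℕ) (T : Fin q → ℝ≥0 → Ω → ℝ≥0)
    (t : ℝ≥0) (ω : Ω) : EuclideanSpace ℝ (Fin q) :=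
  WithLp.toLp 2 fun i => (M i (T i t ω) ω : ℝ)

/-- The Cartesian product `A_1 × ⋯ × A_q`. -/
def box {q : ℕ} (A : Fin q → Set ℝ) : Set (EuclideanSpace ℝ (Fin q)) :=
  {x | ∀ i, x i ∈ A i}

/-- `η = n_1 + ⋯ + n_k`. -/
def eta {k : ℕ} (f : Fin k → ℕ) : ℕ := ∑ j, f j

/-- `∏_j (r_j / (a + r_1 + ⋯ + r_k)) ^ {n_j} / n_j!`. -/
def jumpWeight {k : ℕ} (a : ℝ) (r : Fin k → ℝ) (f : Fin k → ℕ) : ℝ :=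
  ∏ j, (r j / (a + ∑ l, r l)) ^ f j * (1 / (f j)!)

/-- The contribution of the jumps along the coordinate axes: the sum over `i` and over
`n_i = m + 1 ≥ 1` of the mass at the point whose `i`-th coordinate is `n_i` and whose other
coordinates vanish, if that point lies in the product of the `A_i`. -/
def axisPart {q : ℕ} (lam : ℝ) (k : Fin q → ℕ) (r : (i : Fin q) → Fin (k i) → ℝ)
    (a : Fin q → ℝ) (A : Fin q → Set ℝ) : ℝ≥0∞ :=
  ∑ i, ∑' m : ℕ,
    ENNReal.ofReal (lam * ∑ f ∈ omegaSet (k i) (m + 1),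
      Real.Gamma (eta f) * jumpWeight (a i) (r i) f)
    * (Set.indicator (A i) 1 ((m + 1 : ℕ) : ℝ)
      * ∏ j ∈ Finset.univ.erase i, Set.indicator (A j) 1 (0 : ℝ))

/-- The contribution of the jumps of the negative binomial clock: a series over `n ≠ 0` in `ℕ^q`
and over `l + 1 ≥ 1`. -/
def clockPart {q : ℕ} (lam θ : ℝ) (k : Fin q → ℕ) (r : (i : Fin q) → Fin (k i) → ℝ)
    (a : Fin q → ℝ) (A : Fin q → Set ℝ) : ℝ≥0∞ :=
  ∑' n : {n : Fin q → ℕ // n ≠ 0}, ∑' l : ℕ,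
    ENNReal.ofReal (lam * (θ ^ (l + 1) / ((l + 1 : ℕ) : ℝ)
      * ∏ i, ((a i / (a i + ∑ j, r i j)) ^ (l + 1)
        * ∑ f ∈ omegaSet (k i) (n.1 i),
            (ascPochhammer ℝ (eta f)).eval ((l + 1 : ℕ) : ℝ) * jumpWeight (a i) (r i) f)))
    * ∏ i, Set.indicator (A i) 1 ((n.1 i : ℕ) : ℝ)

end

/-! Let `ψ_i` be the characteristic exponent of `M_i` (`gcpExponent`). If `T` is a joint
subordinator independent of `M`, with joint Laplace exponent `Φ`, then conditioning on `T` shows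
that the increments of `(M_i(T_i))` have the joint characteristic function of independent stationary
increments with exponent `Φ(ψ_1(u_1), …, ψ_q(u_q))` (`isLevy_timeChange`). For the gamma processes
`Φ(w) = γ(w) = -λ ∑ log(1 - w_i / a_i)`. For the `G_i`, conditioning on the negative binomial clock
gives `γ + λ (log(1 - θ) - log(1 - θ exp(γ / λ)))`.

The Lévy measures come from expanding these exponents. With `z_i = ∑_j (λ_ij / (a_i + λ_i)) exp(i j
u_i)` one has `|z_i| < 1` and `1 - ψ_i / a_i = ((a_i + λ_i) / a_i)(1 - z_i)`
(`one_sub_gcpExponent_div`). The logarithmic series of `-log(1 - z_i)`, expanded multinomially and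
sorted by powers of `exp(i u_i)`, gives the axis part. The clock contributes `λ ∑_k (θ^k / k)(exp(kγ
/ λ) - 1)`, where `exp(kγ / λ) = ∏_i (1 - ψ_i / a_i)^(-k)` is expanded by the negative binomial
series; this is the second part. Both measures are finite and have no mass in the open unit ball, so
they satisfy the Lévy–Khintchine formula with zero drift and zero Gaussian part.

Uniqueness (`eq_of_levyExponent_eq`) uses second symmetric differences of the exponent in a
direction `v`. They remove the drift and the truncation, and up to sign they are the characteristic
function of a finite measure with density `2 - 2 cos⟨x, v⟩` with respect to `ν`, apart from an atom
at `0`. Countably many `v` recover `ν` away from `0`. -/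

noncomputable section

/-! ### Series over finitely supported exponents -/

/-- Summing a convergent series first over the finite fibres of a degree function. -/
theorem HasSum.finset_fiberwise {β γ E : Type*} [NormedAddCommGroup E] [DecidableEq γ]
    {F : β → E} {S : E} (hF : HasSum F S) (d : β → γ) (fib : γ → Finset β)
    (hfib : ∀ n f, f ∈ fib n ↔ d f = n) :
    HasSum (fun n => ∑ f ∈ fib n, F f) S := by
  have h := (Equiv.sigmaFiberEquiv d).hasSum_iff.mpr hF
  refine h.sigma fun n => ?_
  have : ∑ f ∈ fib n, F f = ∑ f : {f // f ∈ fib n}, F f := (Finset.sum_coe_sort _ _).symm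
  rw [this]
  let e : {f // d f = n} ≃ {f // f ∈ fib n} := Equiv.subtypeEquivRight fun f => (hfib n f).symm
  exact (e.hasSum_iff (f := fun f : {f // f ∈ fib n} => F f)).mpr (hasSum_fintype _)

/-- A series converges once its sums over the finite fibres of a degree function do, absolutely. -/
theorem HasSum.of_finset_fiberwise {β γ : Type*} [DecidableEq γ]
    {F : β → ℂ} {S : ℂ} (d : β → γ) (fib : γ → Finset β)
    (hfib : ∀ n f, f ∈ fib n ↔ d f = n)
    (hs : Summable fun n => ∑ f ∈ fib n, ‖F f‖)
    (hF : HasSum (fun n => ∑ f ∈ fib n, F f) S) : HasSum F S := by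
  have hfin : ∀ {E : Type} [AddCommMonoid E] [TopologicalSpace E] (G : β → E) (n : γ),
      HasSum (fun f : {f // d f = n} => G f) (∑ f ∈ fib n, G f) := by
    intro E _ _ G n
    have : ∑ f ∈ fib n, G f = ∑ f : {f // f ∈ fib n}, G f := (Finset.sum_coe_sort _ _).symm
    rw [this]
    let e : {f // d f = n} ≃ {f // f ∈ fib n} := Equiv.subtypeEquivRight fun f => (hfib n f).symm
    exact (e.hasSum_iff (f := fun f : {f // f ∈ fib n} => G f)).mpr (hasSum_fintype _)
  have hsum : Summable fun x : (n : γ) × {f // d f = n} => ‖F x.2‖ := by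
    rw [summable_sigma_of_nonneg fun _ => norm_nonneg _]
    refine ⟨fun n => (hfin (fun f => ‖F f‖) n).summable, ?_⟩
    refine hs.congr fun n => ?_
    exact ((hfin (fun f => ‖F f‖) n).tsum_eq).symm
  have h := HasSum.sigma_of_hasSum (f := fun x : (n : γ) × {f // d f = n} => F x.2) hF
    (fun n => hfin F n) hsum.of_norm
  exact (Equiv.sigmaFiberEquiv d).hasSum_iff.mp h

theorem sum_piAntidiag_prod_pow_div_factorial {K : Type*} [Field K] [CharZero K] {k : ℕ}
    (z : Fin k → K) (n : ℕ) :
    ∑ f ∈ Finset.univ.piAntidiag n, ∏ j, z j ^ f j / (f j)! = (∑ j, z j) ^ n / n ! := by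
  rw [Finset.sum_pow_eq_sum_piAntidiag, Finset.sum_div]
  refine Finset.sum_congr rfl fun f hf => ?_
  have hn : ∑ j, f j = n := (Finset.mem_piAntidiag.mp hf).1
  have h := Nat.multinomial_spec Finset.univ f
  rw [hn] at h
  rw [Finset.prod_div_distrib, ← h]
  have h1 : (∏ j, ((f j)! : K)) ≠ 0 :=
    Finset.prod_ne_zero_iff.mpr fun j _ => Nat.cast_ne_zero.mpr (Nat.factorial_ne_zero _)
  have h2 : (Nat.multinomial Finset.univ f : K) ≠ 0 :=
    Nat.cast_ne_zero.mpr (Nat.multinomial_pos _ _).ne'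
  push_cast
  field_simp

/-- A multinomial series: `∑_f c(|f|) ∏ z_j ^ f_j / f_j!` is `∑_n c(n) (∑ z_j) ^ n / n!`. -/
theorem hasSum_multinomial {k : ℕ} (c : ℕ → ℝ) (hc : ∀ n, 0 ≤ c n) (z : Fin k → ℂ) {S : ℂ}
    (hs : Summable fun n => c n / n ! * (∑ j, ‖z j‖) ^ n)
    (hS : HasSum (fun n => ((c n / n ! : ℝ) : ℂ) * (∑ j, z j) ^ n) S) :
    HasSum (fun f : Fin k → ℕ => (c (eta f) : ℂ) * ∏ j, z j ^ f j / (f j)!) S := by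
  have hmem : ∀ (n : ℕ) (f : Fin k → ℕ), f ∈ Finset.univ.piAntidiag n ↔ eta f = n := by
    intro n f
    simp [Finset.mem_piAntidiag, eta]
  refine HasSum.of_finset_fiberwise eta (fun n => Finset.univ.piAntidiag n) hmem ?_ ?_
  · refine hs.congr fun n => ?_
    rw [div_mul_eq_mul_div, mul_div_assoc, ← sum_piAntidiag_prod_pow_div_factorial,
      Finset.mul_sum]
    refine Finset.sum_congr rfl fun f hf => ?_
    rw [(hmem n f).mp hf]
    simp [norm_prod, abs_of_nonneg (hc n)]
  · refine hS.congr_fun fun n => Eq.symm ?_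
    rw [Complex.ofReal_div, div_mul_eq_mul_div, mul_div_assoc, Complex.ofReal_natCast,
      ← sum_piAntidiag_prod_pow_div_factorial, Finset.mul_sum]
    refine Finset.sum_congr rfl fun f hf => ?_
    rw [(hmem n f).mp hf]

/-- Allows a product of `q` series to be treated as an integral over a product of counting measures,
where Fubini applies. -/
theorem measure_pi_count_eq_count {q : ℕ} :
    Measure.pi (fun _ : Fin q => (Measure.count : Measure ℕ)) = Measure.count := by
  refine Measure.ext_of_singleton fun n => ?_
  rw [Measure.pi_singleton]
  simp

/-- A product of finitely many absolutely convergent series. -/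
theorem hasSum_pi_prod {q : ℕ} {g : Fin q → ℕ → ℂ} {S : Fin q → ℂ}
    (hg : ∀ i, HasSum (g i) (S i)) :
    HasSum (fun n : Fin q → ℕ => ∏ i, g i (n i)) (∏ i, S i) := by
  have hi : ∀ i, Integrable (g i) Measure.count := fun i =>
    integrable_count_iff.mpr (hg i).summable.norm
  have h1 := Integrable.fintype_prod_dep hi
  have h2 := integral_fintype_prod_eq_prod (μ := fun _ : Fin q => (Measure.count : Measure ℕ)) g
  rw [measure_pi_count_eq_count] at h1 h2
  have h3 : ∀ i, ∫ x, g i x ∂Measure.count = S i := fun i => by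
    rw [integral_countable (hi i)]
    simpa [Measure.real] using (hg i).tsum_eq
  have h4 := (integrable_count_iff.mp h1).of_norm.hasSum
  rw [integral_countable h1] at h2
  simp only [h3] at h2
  rw [← h2]
  simpa [Measure.real] using h4

theorem ascPochhammer_eval_nonneg {s : ℝ} (hs : 0 ≤ s) (n : ℕ) :
    0 ≤ (ascPochhammer ℝ n).eval s := by
  induction n with
  | zero => simp
  | succ n ih =>
    rw [ascPochhammer_succ_eval]
    positivity

theorem ofReal_ascPochhammer_eval (s : ℝ) (n : ℕ) :
    (((ascPochhammer ℝ n).eval s : ℝ) : ℂ) = (ascPochhammer ℂ n).eval (s : ℂ) := by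
  induction n with
  | zero => simp
  | succ n ih => rw [ascPochhammer_succ_eval, ascPochhammer_succ_eval, ← ih]; push_cast; ring

/-- The negative binomial series. -/
theorem hasSum_negBinomial (s : ℝ) {z : ℂ} (hz : ‖z‖ < 1) :
    HasSum (fun n : ℕ => (((ascPochhammer ℝ n).eval s / n ! : ℝ) : ℂ) * z ^ n)
      (Complex.exp (-(s * Complex.log (1 - z)))) := by
  have h := (Complex.one_div_one_sub_cpow_hasFPowerSeriesOnBall_zero (s : ℂ)).hasSum
    (y := z) (by
      rw [Metric.mem_eball, edist_zero_right, ← ofReal_norm, ← ENNReal.ofReal_one]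
      exact (ENNReal.ofReal_lt_ofReal_iff one_pos).mpr hz)
  have hne : 1 - z ≠ 0 := by
    intro h0
    have : z = 1 := by linear_combination -h0
    simp [this] at hz
  simp only [zero_add] at h
  rw [Complex.cpow_def_of_ne_zero hne, one_div, ← Complex.exp_neg, mul_comm _ (s : ℂ)] at h
  refine h.congr_fun fun n => Eq.symm ?_
  -- The power series of `(1 - z)^(-s)` has binomial coefficients; multiplied by `n!` they are
  -- rising factorials.
  have h1 := Ring.factorial_nsmul_multichoose_eq_ascPochhammer (s : ℂ) n
  rw [Ring.multichoose_eq, Polynomial.ascPochhammer_smeval_eq_eval, nsmul_eq_mul] at h1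
  have h2 : ((n ! : ℕ) : ℂ) ≠ 0 := Nat.cast_ne_zero.mpr (Nat.factorial_ne_zero _)
  rw [Complex.ofReal_div, ofReal_ascPochhammer_eval, ← h1, Complex.ofReal_natCast,
    mul_div_cancel_left₀ _ h2]
  simp [FormalMultilinearSeries.ofScalars]

theorem summable_negBinomial {s : ℝ} {x : ℝ} (hx0 : 0 ≤ x) (hx : x < 1) :
    Summable fun n : ℕ => (ascPochhammer ℝ n).eval s / n ! * x ^ n := by
  have h := (hasSum_negBinomial s (z := x) (by simpa [abs_of_nonneg hx0] using hx)).summable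
  exact_mod_cast h

/-! ### Transforms of the one-dimensional laws -/

section Transforms

variable {Ω : Type*} [MeasurableSpace Ω] {P : Measure Ω}

theorem hasSum_integral_comp_nat [IsFiniteMeasure P] {N : Ω → ℕ} (hN : Measurable N)
    {g : ℕ → ℂ} {C : ℝ} (hg : ∀ n, ‖g n‖ ≤ C) :
    HasSum (fun n => (P.real {ω | N ω = n} : ℂ) * g n) (∫ ω, g (N ω) ∂P) := by
  have hi : Integrable g (P.map N) :=
    Integrable.of_bound (Measurable.of_discrete).aestronglyMeasurable C (ae_of_all _ hg)
  rw [← integral_map hN.aemeasurable (f := g) Measurable.of_discrete.aestronglyMeasurable,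
    integral_countable hi]
  have hn : ∀ n, (P.map N).real {n} = P.real {ω | N ω = n} := fun n => by
    rw [map_measureReal_apply hN (measurableSet_singleton n)]
    rfl
  have hs : Summable fun n => (P.map N).real {n} • g n := by
    have h1 : Summable fun n => (P.map N).real {n} := by
      refine ENNReal.summable_toReal (f := fun n => P.map N {n}) ?_
      have h2 := tsum_measure_preimage_singleton (μ := P.map N) (s := Set.univ) (f := id)
        Set.countable_univ (fun y _ => measurableSet_preimage measurable_id
          (measurableSet_singleton y))
      have h3 : ∑' n : ℕ, P.map N {n} = P.map N Set.univ := by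
        rw [tsum_univ (f := fun n => P.map N (id ⁻¹' {n}))] at h2
        simpa using h2
      rw [h3]
      exact measure_ne_top _ _
    refine Summable.of_norm_bounded (h1.mul_right C) fun n => ?_
    rw [norm_smul, Real.norm_of_nonneg measureReal_nonneg]
    exact mul_le_mul_of_nonneg_left (hg n) measureReal_nonneg
  refine hs.hasSum.congr_fun fun n => ?_
  rw [hn, Complex.real_smul]

theorem norm_exp_I_mul_le (x : ℝ) : ‖Complex.exp (Complex.I * x)‖ ≤ 1 := by
  rw [mul_comm, Complex.norm_exp_ofReal_mul_I]

/-- The exponent of the characteristic function of a generalized counting process. -/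
def gcpExponent {k : ℕ} (r : Fin k → ℝ) (u : ℝ) : ℂ :=
  ∑ j, (r j : ℂ) * (Complex.exp (Complex.I * u) ^ ((j : ℕ) + 1) - 1)

/-- Places these exponents in the closed left half plane, where the Laplace transforms of the random
times are available. -/
theorem gcpExponent_re_nonpos {k : ℕ} {r : Fin k → ℝ} (hr : ∀ j, 0 < r j) (u : ℝ) :
    (gcpExponent r u).re ≤ 0 := by
  rw [gcpExponent, Complex.re_sum]
  refine Finset.sum_nonpos fun j _ => ?_
  rw [Complex.re_ofReal_mul, Complex.sub_re, Complex.one_re]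
  have h1 : (Complex.exp (Complex.I * u) ^ ((j : ℕ) + 1)).re ≤ 1 := by
    refine (Complex.re_le_norm _).trans ?_
    rw [norm_pow]
    exact pow_le_one₀ (norm_nonneg _) (norm_exp_I_mul_le u)
  nlinarith [hr j]

/-- The collected power of `e` is the weight that defines `omegaSet`, so sorting a multinomial
series by powers of `e` produces sums over `Ω(k, n)`. -/
theorem prod_mul_pow_succ_pow {k : ℕ} (p : Fin k → ℂ) (e : ℂ) (f : Fin k → ℕ) :
    ∏ j, (p j * e ^ ((j : ℕ) + 1)) ^ f j / (f j)! =
      e ^ (∑ j : Fin k, ((j : ℕ) + 1) * f j) * ∏ j, p j ^ f j / (f j)! := by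
  rw [← Finset.prod_pow_eq_pow_sum, ← Finset.prod_mul_distrib]
  refine Finset.prod_congr rfl fun j _ => ?_
  rw [mul_pow, ← pow_mul]
  ring

/-- The multinomial series with weights `p_j e ^ j`, arranged by powers of `e`. -/
theorem hasSum_omegaSet {k : ℕ} (c : ℕ → ℝ) (hc : ∀ n, 0 ≤ c n) (p : Fin k → ℝ)
    (hp : ∀ j, 0 ≤ p j) {e : ℂ} (he : ‖e‖ ≤ 1) {S : ℂ}
    (hs : Summable fun n => c n / n ! * (∑ j, p j) ^ n)
    (hS : HasSum (fun n => ((c n / n ! : ℝ) : ℂ) * (∑ j, p j * e ^ ((j : ℕ) + 1)) ^ n) S) :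
    HasSum (fun n => ((∑ f ∈ omegaSet k n, c (eta f) * ∏ j, p j ^ f j / (f j)! : ℝ) : ℂ) * e ^ n)
      S := by
  have h1 := hasSum_multinomial c hc (fun j => (p j : ℂ) * e ^ ((j : ℕ) + 1)) (S := S) ?_ hS
  · have h2 := h1.finset_fiberwise (fun f => ∑ j : Fin k, ((j : ℕ) + 1) * f j)
      (fun n => omegaSet k n) (fun n f => mem_omegaSet)
    refine h2.congr_fun fun n => ?_
    push_cast
    rw [Finset.sum_mul]
    refine Finset.sum_congr rfl fun f hf => ?_
    rw [prod_mul_pow_succ_pow, mem_omegaSet.mp hf]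
    ring
  · refine Summable.of_nonneg_of_le (fun n => ?_) (fun n => ?_) hs
    · have := hc n
      positivity
    · have := hc n
      gcongr with j
      rw [norm_mul, norm_pow, Complex.norm_of_nonneg (hp j)]
      exact mul_le_of_le_one_right (hp j) (pow_le_one₀ (norm_nonneg _) he)

/-- With `c = 1` the multinomial series is the exponential series; the factors `exp(-r_j t)` of the
mass function supply the `-1` in each term of the exponent. -/
theorem IsGCP.integral_exp [IsProbabilityMeasure P] {k : ℕ} {r : Fin k → ℝ}
    (hr : ∀ j, 0 < r j) {N : ℝ≥0 → Ω → ℕ} (hN : IsGCP P r N) (t : ℝ≥0) (u : ℝ) :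
    ∫ ω, Complex.exp (Complex.I * ((u * N t ω : ℝ) : ℂ)) ∂P =
      Complex.exp ((t : ℝ) * gcpExponent r u) := by
  set e := Complex.exp (Complex.I * u) with he
  have hen : ‖e‖ ≤ 1 := norm_exp_I_mul_le u
  have h1 := hasSum_integral_comp_nat (P := P) (hN.measurable t) (g := fun n => e ^ n) (C := 1)
    fun n => by rw [norm_pow]; exact pow_le_one₀ (norm_nonneg _) hen
  have h2 : ∀ n : ℕ, Complex.exp (Complex.I * ((u * n : ℝ) : ℂ)) = e ^ n := fun n => by
    rw [he, ← Complex.exp_nat_mul]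
    push_cast
    ring_nf
  simp only [h2]
  refine h1.unique ?_
  have h3 := hasSum_omegaSet (fun _ => 1) (fun _ => zero_le_one) (fun j => r j * t)
    (fun j => mul_nonneg (hr j).le t.2) (e := e) hen
    (S := Complex.exp (∑ j, ((r j * t : ℝ) : ℂ) * e ^ ((j : ℕ) + 1))) ?_ ?_
  · have h4 := h3.mul_left (Complex.exp (-(∑ j, ((r j * t : ℝ) : ℂ))))
    rw [← Complex.exp_add] at h4
    convert! h4 using 1
    · funext n
      rw [hN.pmf, ← mul_assoc]
      congr 1
      rw [← Complex.ofReal_sum, ← Complex.ofReal_neg, ← Complex.ofReal_exp, ← Complex.ofReal_mul,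
        Finset.mul_sum, ← Finset.sum_neg_distrib, Real.exp_sum]
      congr 1
      refine Finset.sum_congr rfl fun f _ => ?_
      rw [one_mul, ← Finset.prod_mul_distrib]
      refine Finset.prod_congr rfl fun j _ => ?_
      ring
    · congr 1
      rw [gcpExponent, Finset.mul_sum, ← Finset.sum_neg_distrib, ← Finset.sum_add_distrib]
      refine Finset.sum_congr rfl fun j _ => ?_
      push_cast
      ring
  · simpa [div_eq_inv_mul] using Real.summable_pow_div_factorial (∑ j, r j * t)
  · have := NormedSpace.expSeries_div_hasSum_exp (∑ j, ((r j * t : ℝ) : ℂ) * e ^ ((j : ℕ) + 1))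
    rw [← Complex.exp_eq_exp_ℂ] at this
    refine this.congr_fun fun n => ?_
    push_cast
    ring

theorem one_sub_ne_zero_of_norm_lt_one {z : ℂ} (hz : ‖z‖ < 1) : 1 - z ≠ 0 := by
  intro h0
  have : z = 1 := by linear_combination -h0
  simp [this] at hz

/-- The exponent of the generating function of a negative binomial process. -/
def negBinExponent (θ : ℝ) (x : ℂ) : ℂ := Real.log (1 - θ) - Complex.log (1 - θ * x)

theorem norm_ofReal_mul_lt_one {θ : ℝ} (hθ0 : 0 < θ) (hθ1 : θ < 1) {x : ℂ} (hx : ‖x‖ ≤ 1) :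
    ‖(θ : ℂ) * x‖ < 1 := by
  rw [norm_mul, Complex.norm_of_nonneg hθ0.le]
  nlinarith [norm_nonneg x]

/-- Complex `x` in the closed disc is needed: the formula is applied at `x = exp(γ / λ)` with `γ` a
gamma Laplace exponent. -/
theorem IsNegBinProcess.integral_pow [IsProbabilityMeasure P] {θ : ℝ} (hθ0 : 0 < θ) (hθ1 : θ < 1)
    {B : ℝ≥0 → Ω → ℕ} (hB : IsNegBinProcess P θ B) (t : ℝ≥0) {x : ℂ} (hx : ‖x‖ ≤ 1) :
    ∫ ω, x ^ B t ω ∂P = Complex.exp ((t : ℝ) * negBinExponent θ x) := by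
  have h1 := hasSum_integral_comp_nat (P := P) (hB.measurable t) (g := fun n => x ^ n) (C := 1)
    fun n => by rw [norm_pow]; exact pow_le_one₀ (norm_nonneg _) hx
  refine h1.unique ?_
  have h2 := (hasSum_negBinomial t (norm_ofReal_mul_lt_one hθ0 hθ1 hx)).mul_left
    (((1 - θ) ^ (t : ℝ) : ℝ) : ℂ)
  convert! h2 using 1
  · funext n
    rw [hB.pmf, mul_pow]
    push_cast
    ring
  · rw [Real.rpow_def_of_pos (by linarith), Complex.ofReal_exp, ← Complex.exp_add, negBinExponent]
    congr 1
    push_cast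
    ring

theorem gammaPDFReal_mul_exp (c a y x : ℝ) :
    gammaPDFReal c a x * Real.exp (y * x) = Set.indicator (Set.Ici 0)
      (fun x => a ^ c / Real.Gamma c * (x ^ (c - 1) * Real.exp (-((a - y) * x)))) x := by
  rw [gammaPDFReal, Set.indicator_apply]
  simp only [Set.mem_Ici]
  split_ifs
  · rw [mul_assoc, ← Real.exp_add, mul_assoc]
    ring_nf
  · simp

theorem toReal_gammaPDF {c a : ℝ} (hc : 0 < c) (ha : 0 < a) (x : ℝ) :
    (gammaPDF c a x).toReal = gammaPDFReal c a x :=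
  ENNReal.toReal_ofReal (gammaPDFReal_nonneg hc ha x)

theorem measurable_gammaPDF (c a : ℝ) : Measurable (gammaPDF c a) :=
  (measurable_gammaPDFReal c a).ennreal_ofReal

theorem integrable_exp_mul_gammaMeasure {c a y : ℝ} (hc : 0 < c) (ha : 0 < a) (hy : y < a) :
    Integrable (fun x => Real.exp (y * x)) (gammaMeasure c a) := by
  rw [gammaMeasure, integrable_withDensity_iff_integrable_smul' (measurable_gammaPDF c a)
    (ae_of_all _ fun x => ENNReal.ofReal_lt_top)]
  simp only [toReal_gammaPDF hc ha, smul_eq_mul, gammaPDFReal_mul_exp]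
  rw [integrable_indicator_iff measurableSet_Ici, IntegrableOn]
  refine Integrable.const_mul ?_ _
  change IntegrableOn _ _ _
  rw [integrableOn_Ici_iff_integrableOn_Ioi]
  -- The integral of a non-integrable function is `0` by convention, so a nonzero value proves
  -- integrability.
  refine not_imp_comm.1 integral_undef ?_
  rw [Real.integral_rpow_mul_exp_neg_mul_Ioi hc (sub_pos.mpr hy)]
  have := Real.Gamma_pos_of_pos hc
  have := sub_pos.mpr hy
  positivity

theorem mgf_gammaMeasure {c a y : ℝ} (hc : 0 < c) (ha : 0 < a) (hy : y < a) :
    ∫ x, Real.exp (y * x) ∂gammaMeasure c a = Real.exp (-(c * Real.log (1 - y / a))) := by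
  rw [gammaMeasure, integral_withDensity_eq_integral_toReal_smul (measurable_gammaPDF c a)
    (ae_of_all _ fun x => ENNReal.ofReal_lt_top)]
  simp only [toReal_gammaPDF hc ha, smul_eq_mul, gammaPDFReal_mul_exp]
  have hay := sub_pos.mpr hy
  rw [integral_indicator measurableSet_Ici, integral_const_mul, integral_Ici_eq_integral_Ioi,
    Real.integral_rpow_mul_exp_neg_mul_Ioi hc hay]
  have hG := Real.Gamma_pos_of_pos hc
  rw [show 1 - y / a = (a - y) / a by field_simp, Real.log_div hay.ne' ha.ne',
    Real.rpow_def_of_pos ha, Real.rpow_def_of_pos (by positivity), one_div, Real.log_inv]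
  rw [show -(c * (Real.log (a - y) - Real.log a)) = Real.log a * c + -Real.log (a - y) * c by ring,
    Real.exp_add]
  field_simp

/-- The Laplace transform of the gamma distribution on a half plane. -/
theorem integral_cexp_gammaMeasure {c a : ℝ} (hc : 0 < c) (ha : 0 < a) {w : ℂ} (hw : w.re < a) :
    ∫ x, Complex.exp (w * x) ∂gammaMeasure c a =
      Complex.exp (-(c * Complex.log (1 - w / a))) := by
  have hsub : {z : ℂ | z.re < a} ⊆
      {z | z.re ∈ interior (integrableExpSet id (gammaMeasure c a))} := by
    intro z hz
    refine mem_interior.mpr ⟨Set.Iio a, fun y hy => ?_, isOpen_Iio, hz⟩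
    exact integrable_exp_mul_gammaMeasure hc ha hy
  have hf : AnalyticOnNhd ℂ (complexMGF id (gammaMeasure c a)) {z : ℂ | z.re < a} :=
    analyticOnNhd_complexMGF.mono hsub
  have hg : AnalyticOnNhd ℂ (fun z : ℂ => Complex.exp (-(c * Complex.log (1 - z / a))))
      {z : ℂ | z.re < a} := by
    intro z hz
    refine AnalyticAt.cexp (AnalyticAt.neg (analyticAt_const.mul (AnalyticAt.clog ?_ ?_)))
    · exact analyticAt_const.sub (analyticAt_id.div_const)
    -- On this half plane `1 - z / a` has positive real part, so it avoids the branch cut of the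
    -- logarithm.
    · left
      have : (1 - z / a).re = 1 - z.re / a := by simp
      rw [this, sub_pos, div_lt_one ha]
      exact hz
  have hU : IsPreconnected {z : ℂ | z.re < a} := (convex_halfSpace_re_lt a).isPreconnected
  -- Identity theorem: both sides are analytic on a connected half plane and agree at real points
  -- accumulating at `0`.
  refine AnalyticOnNhd.eqOn_of_preconnected_of_frequently_eq (z₀ := 0) hf hg hU (by simpa using ha)
    ?_ hw
  have ht : Tendsto (fun y : ℝ => (y : ℂ)) (𝓝[≠] 0) (𝓝[≠] 0) := by
    refine tendsto_nhdsWithin_iff.mpr ⟨?_, ?_⟩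
    · exact (Complex.continuous_ofReal.tendsto' 0 0 (by simp)).mono_left nhdsWithin_le_nhds
    · filter_upwards [self_mem_nhdsWithin] with y hy
      simpa using hy
  refine ht.frequently (Eventually.frequently ?_)
  filter_upwards [nhdsWithin_le_nhds (Iio_mem_nhds ha)] with y hy
  have hy' : 0 < 1 - y / a := by rw [sub_pos, div_lt_one ha]; exact hy
  rw [complexMGF_ofReal]
  have h := mgf_gammaMeasure hc ha hy
  have h2 : mgf id (gammaMeasure c a) y = ∫ x, Real.exp (y * x) ∂gammaMeasure c a := rfl
  rw [h2, h]
  push_cast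
  rw [← Complex.ofReal_one, ← Complex.ofReal_div, ← Complex.ofReal_sub,
    Complex.ofReal_log hy'.le]

end Transforms

/-! ### Uniqueness in the Lévy–Khintchine formula -/

section LevyKhintchine

variable {q : ℕ}

/-- For `t = 1 / (1 + |x| + |y|)` the imaginary parts of `t x` and `t y` lie in `[-1, 1]`, where
`exp` is injective. Having all times `t` thus replaces the choice of a continuous logarithm in `u`.
-/
theorem eq_of_forall_exp_mul_eq {x y : ℂ}
    (h : ∀ t : ℝ≥0, Complex.exp ((t : ℝ) * x) = Complex.exp ((t : ℝ) * y)) : x = y := by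
  set t : ℝ := 1 / (1 + ‖x‖ + ‖y‖) with ht
  have hd : 0 < 1 + ‖x‖ + ‖y‖ := by positivity
  have ht0 : 0 < t := by positivity
  have hb : ∀ z : ℂ, ‖z‖ ≤ ‖x‖ + ‖y‖ → |((t : ℂ) * z).im| ≤ 1 := by
    intro z hz
    refine (Complex.abs_im_le_norm _).trans ?_
    rw [norm_mul, Complex.norm_of_nonneg ht0.le, ht, one_div, inv_mul_le_iff₀ hd]
    linarith
  have hx := abs_le.mp (hb x (by linarith [norm_nonneg y]))
  have hy := abs_le.mp (hb y (by linarith [norm_nonneg x]))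
  have hpi := Real.pi_gt_three
  have h0 : Complex.exp (t * x) = Complex.exp (t * y) := h ⟨t, ht0.le⟩
  have h1 := Complex.exp_inj_of_neg_pi_lt_of_le_pi (by linarith) (by linarith) (by linarith)
    (by linarith) h0
  exact mul_left_cancel₀ (Complex.ofReal_ne_zero.mpr ht0.ne') h1

/-- The integrand in the Lévy–Khintchine formula. -/
def levyIntegrand (u x : EuclideanSpace ℝ (Fin q)) : ℂ :=
  Complex.exp (Complex.I * (inner ℝ x u : ℝ)) - 1
    - Complex.I * (Set.indicator {y | ‖y‖ < 1} (fun y => inner ℝ y u) x : ℝ)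

theorem norm_exp_I_sub_one_sub_le (s : ℝ) :
    ‖Complex.exp (Complex.I * s) - 1 - Complex.I * s‖ ≤ 3 * s ^ 2 := by
  have hn : ‖Complex.I * (s : ℂ)‖ = |s| := by simp
  by_cases h : |s| ≤ 1
  · have := Complex.norm_exp_sub_one_sub_id_le (x := Complex.I * s) (by rwa [hn])
    rw [hn, sq_abs] at this
    nlinarith [sq_nonneg s]
  · push Not at h
    have h1 : ‖Complex.exp (Complex.I * s) - 1 - Complex.I * s‖ ≤ 1 + 1 + |s| := by
      refine (norm_sub_le _ _).trans (add_le_add ((norm_sub_le _ _).trans ?_) hn.le)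
      exact add_le_add (norm_exp_I_mul_le s) (by simp)
    rw [← sq_abs]
    nlinarith

theorem norm_levyIntegrand_le (u x : EuclideanSpace ℝ (Fin q)) :
    ‖levyIntegrand u x‖ ≤ (2 + 3 * ‖u‖ ^ 2) * min 1 (‖x‖ ^ 2) := by
  rw [levyIntegrand]
  have hxu : |inner ℝ x u| ≤ ‖x‖ * ‖u‖ := abs_real_inner_le_norm x u
  by_cases hx : ‖x‖ < 1
  · rw [Set.indicator_of_mem (by exact hx), min_eq_right (by nlinarith [norm_nonneg x])]
    refine (norm_exp_I_sub_one_sub_le _).trans ?_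
    have := mul_self_le_mul_self (abs_nonneg _) hxu
    rw [abs_mul_abs_self] at this
    nlinarith [sq_nonneg ‖x‖]
  · rw [Set.indicator_of_notMem (by exact hx), min_eq_left (by nlinarith)]
    have : ‖Complex.exp (Complex.I * (inner ℝ x u : ℝ)) - 1‖ ≤ 1 + 1 :=
      (norm_sub_le _ _).trans (add_le_add (norm_exp_I_mul_le _) (by simp))
    simp only [Complex.ofReal_zero, mul_zero, sub_zero]
    nlinarith [sq_nonneg ‖u‖]

theorem measurable_levyIntegrand (u : EuclideanSpace ℝ (Fin q)) :
    Measurable (levyIntegrand u) := by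
  unfold levyIntegrand
  have h1 : Measurable fun x : EuclideanSpace ℝ (Fin q) => inner ℝ x u := by fun_prop
  have h2 := h1.indicator (measurableSet_lt measurable_norm measurable_const :
    MeasurableSet {y : EuclideanSpace ℝ (Fin q) | ‖y‖ < 1})
  fun_prop

variable {ν : Measure (EuclideanSpace ℝ (Fin q))}

theorem integrable_min_norm_sq (hν : ∫⁻ x, ENNReal.ofReal (min 1 (‖x‖ ^ 2)) ∂ν < ∞) :
    Integrable (fun x : EuclideanSpace ℝ (Fin q) => min 1 (‖x‖ ^ 2)) ν := by
  refine ⟨by fun_prop, ?_⟩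
  rw [hasFiniteIntegral_iff_ofReal (ae_of_all _ fun x => by positivity)]
  exact hν

theorem integrable_levyIntegrand (hν : ∫⁻ x, ENNReal.ofReal (min 1 (‖x‖ ^ 2)) ∂ν < ∞)
    (u : EuclideanSpace ℝ (Fin q)) : Integrable (levyIntegrand u) ν :=
  ((integrable_min_norm_sq hν).const_mul (2 + 3 * ‖u‖ ^ 2)).mono'
    (measurable_levyIntegrand u).aestronglyMeasurable
    (ae_of_all _ fun x => norm_levyIntegrand_le u x)

/-- The truncation term is linear in `u` and so cancels in a second symmetric difference. -/
theorem levyIntegrand_add_add_sub (u v x : EuclideanSpace ℝ (Fin q)) :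
    levyIntegrand (u + v) x + levyIntegrand (u - v) x - 2 * levyIntegrand u x =
      -((2 - 2 * Real.cos (inner ℝ x v) : ℝ) * Complex.exp (Complex.I * (inner ℝ x u : ℝ))) := by
  have hi : ∀ w : EuclideanSpace ℝ (Fin q),
      Set.indicator {y | ‖y‖ < 1} (fun y => inner ℝ y w) x =
        Set.indicator {y : EuclideanSpace ℝ (Fin q) | ‖y‖ < 1} (fun _ => 1) x * inner ℝ x w := by
    intro w
    by_cases hx : x ∈ {y : EuclideanSpace ℝ (Fin q) | ‖y‖ < 1} <;> simp [hx]
  simp only [levyIntegrand]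
  rw [hi u, hi (u + v), hi (u - v), inner_add_right, inner_sub_right]
  push_cast
  rw [mul_add, mul_sub, Complex.exp_add, Complex.exp_sub, Complex.two_cos, div_eq_mul_inv,
    ← Complex.exp_neg, mul_comm Complex.I ((inner ℝ x v : ℝ) : ℂ), neg_mul]
  ring

/-- Second symmetric differences of the exponent. -/
theorem levyExponent_add_add_sub (hν : ∫⁻ x, ENNReal.ofReal (min 1 (‖x‖ ^ 2)) ∂ν < ∞)
    (b : EuclideanSpace ℝ (Fin q)) (S : Matrix (Fin q) (Fin q) ℝ)
    (u v : EuclideanSpace ℝ (Fin q)) :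
    levyExponent b S ν (u + v) + levyExponent b S ν (u - v) - 2 * levyExponent b S ν u =
      -(dotProduct v.ofLp (S.mulVec v.ofLp) : ℝ)
      - ∫ x, ((2 - 2 * Real.cos (inner ℝ x v) : ℝ) : ℂ)
          * Complex.exp (Complex.I * (inner ℝ x u : ℝ)) ∂ν := by
  have h1 : ∀ w, levyExponent b S ν w = Complex.I * (inner ℝ b w : ℝ)
      - ((dotProduct w.ofLp (S.mulVec w.ofLp) / 2 : ℝ) : ℂ) + ∫ x, levyIntegrand w x ∂ν :=
    fun w => rfl
  have h2 : ∫ x, ((2 - 2 * Real.cos (inner ℝ x v) : ℝ) : ℂ)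
        * Complex.exp (Complex.I * (inner ℝ x u : ℝ)) ∂ν =
      -((∫ x, levyIntegrand (u + v) x ∂ν) + (∫ x, levyIntegrand (u - v) x ∂ν)
        - 2 * ∫ x, levyIntegrand u x ∂ν) := by
    rw [← integral_const_mul, ← integral_add (integrable_levyIntegrand hν _)
      (integrable_levyIntegrand hν _)]
    erw [← integral_sub ((integrable_levyIntegrand hν _).add
      (integrable_levyIntegrand hν _)) ((integrable_levyIntegrand hν _).const_mul _)]
    rw [← integral_neg]
    refine integral_congr_ae (ae_of_all _ fun x => ?_)
    have := levyIntegrand_add_add_sub u v x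
    simp only [Pi.add_apply, this, neg_neg]
  rw [h2, h1, h1, h1]
  simp only [inner_add_right, inner_sub_right, WithLp.ofLp_add,
    WithLp.ofLp_sub, Matrix.mulVec_add, Matrix.mulVec_sub, dotProduct_add, dotProduct_sub,
    add_dotProduct, sub_dotProduct]
  push_cast
  ring

/-- The finite measure whose characteristic function is a second symmetric difference of the
Lévy–Khintchine exponent. -/
def symmDiffMeasure (S : Matrix (Fin q) (Fin q) ℝ) (ν : Measure (EuclideanSpace ℝ (Fin q)))
    (v : EuclideanSpace ℝ (Fin q)) : Measure (EuclideanSpace ℝ (Fin q)) :=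
  ENNReal.ofReal (dotProduct v.ofLp (S.mulVec v.ofLp)) • Measure.dirac 0
    + ν.withDensity fun x => ENNReal.ofReal (2 - 2 * Real.cos (inner ℝ x v))

theorem two_sub_two_mul_cos_nonneg (s : ℝ) : 0 ≤ 2 - 2 * Real.cos s := by
  linarith [Real.cos_le_one s]

theorem measurable_ofReal_two_sub_cos (v : EuclideanSpace ℝ (Fin q)) :
    Measurable fun x : EuclideanSpace ℝ (Fin q) =>
      ENNReal.ofReal (2 - 2 * Real.cos (inner ℝ x v)) := by
  fun_prop

theorem two_sub_two_mul_cos_inner_le (v x : EuclideanSpace ℝ (Fin q)) :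
    2 - 2 * Real.cos (inner ℝ x v) ≤ (4 + ‖v‖ ^ 2) * min 1 (‖x‖ ^ 2) := by
  have h1 := Real.one_sub_sq_div_two_le_cos (x := inner ℝ x v)
  have h2 := Real.neg_one_le_cos (inner ℝ x v)
  have h3 := mul_self_le_mul_self (abs_nonneg _) (abs_real_inner_le_norm x v)
  rw [abs_mul_abs_self] at h3
  rcases min_cases 1 (‖x‖ ^ 2) with ⟨h, _⟩ | ⟨h, _⟩ <;> rw [h] <;>
    nlinarith [sq_nonneg ‖v‖, sq_nonneg ‖x‖]

theorem lintegral_two_sub_cos_lt_top (hν : ∫⁻ x, ENNReal.ofReal (min 1 (‖x‖ ^ 2)) ∂ν < ∞)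
    (v : EuclideanSpace ℝ (Fin q)) :
    ∫⁻ x, ENNReal.ofReal (2 - 2 * Real.cos (inner ℝ x v)) ∂ν < ∞ := by
  have h := ((integrable_min_norm_sq hν).const_mul (4 + ‖v‖ ^ 2)).lintegral_lt_top
  exact (lintegral_mono fun x => ENNReal.ofReal_le_ofReal
    (two_sub_two_mul_cos_inner_le v x)).trans_lt h

theorem isFiniteMeasure_symmDiffMeasure (S : Matrix (Fin q) (Fin q) ℝ)
    (hν : ∫⁻ x, ENNReal.ofReal (min 1 (‖x‖ ^ 2)) ∂ν < ∞) (v : EuclideanSpace ℝ (Fin q)) :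
    IsFiniteMeasure (symmDiffMeasure S ν v) := by
  have h1 : IsFiniteMeasure (ν.withDensity fun x =>
      ENNReal.ofReal (2 - 2 * Real.cos (inner ℝ x v))) :=
    isFiniteMeasure_withDensity (lintegral_two_sub_cos_lt_top hν v).ne
  have h2 : IsFiniteMeasure (ENNReal.ofReal (dotProduct v.ofLp (S.mulVec v.ofLp)) •
      Measure.dirac (0 : EuclideanSpace ℝ (Fin q))) :=
    Measure.smul_finite _ ENNReal.ofReal_ne_top
  unfold symmDiffMeasure
  infer_instance

theorem charFun_symmDiffMeasure {S : Matrix (Fin q) (Fin q) ℝ} (hS : S.PosSemidef)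
    (hν : ∫⁻ x, ENNReal.ofReal (min 1 (‖x‖ ^ 2)) ∂ν < ∞) (b u v : EuclideanSpace ℝ (Fin q)) :
    charFun (symmDiffMeasure S ν v) u = -(levyExponent b S ν (u + v)
      + levyExponent b S ν (u - v) - 2 * levyExponent b S ν u) := by
  -- Semidefiniteness ensures that `ENNReal.ofReal` does not truncate the mass of the atom at `0`.
  have hSv : 0 ≤ dotProduct v.ofLp (S.mulVec v.ofLp) := by
    simpa using hS.dotProduct_mulVec_nonneg v.ofLp
  have hb : ∀ x : EuclideanSpace ℝ (Fin q),
      ‖Complex.exp ((inner ℝ x u : ℝ) * Complex.I)‖ ≤ 1 := fun x => by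
    rw [Complex.norm_exp_ofReal_mul_I]
  have hm : Measurable fun x : EuclideanSpace ℝ (Fin q) =>
      Complex.exp ((inner ℝ x u : ℝ) * Complex.I) := by fun_prop
  have hfin := isFiniteMeasure_symmDiffMeasure S hν v
  have hi : Integrable (fun x : EuclideanSpace ℝ (Fin q) =>
      Complex.exp ((inner ℝ x u : ℝ) * Complex.I)) (symmDiffMeasure S ν v) :=
    Integrable.of_bound hm.aestronglyMeasurable 1 (ae_of_all _ hb)
  rw [levyExponent_add_add_sub hν, charFun_apply]
  unfold symmDiffMeasure at hi ⊢
  rw [integral_add_measure (integrable_add_measure.mp hi).1 (integrable_add_measure.mp hi).2,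
    integral_smul_measure, integral_dirac,
    integral_withDensity_eq_integral_toReal_smul (measurable_ofReal_two_sub_cos v)
      (ae_of_all _ fun _ => ENNReal.ofReal_lt_top), ENNReal.toReal_ofReal hSv]
  simp only [ENNReal.toReal_ofReal (two_sub_two_mul_cos_nonneg _), Complex.real_smul,
    inner_zero_left, Complex.ofReal_zero, zero_mul, Complex.exp_zero, mul_one]
  simp only [mul_comm _ Complex.I]
  ring

/-- Where `cos⟨x, v⟩ ≠ 1` the density is positive and can be divided out. The Gaussian atom at `0`
lies outside this set. -/
theorem restrict_symmDiffMeasure (S : Matrix (Fin q) (Fin q) ℝ)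
    (ν : Measure (EuclideanSpace ℝ (Fin q))) (v : EuclideanSpace ℝ (Fin q)) :
    ((symmDiffMeasure S ν v).restrict {x | Real.cos (inner ℝ x v) ≠ 1}).withDensity
      (fun x => (ENNReal.ofReal (2 - 2 * Real.cos (inner ℝ x v)))⁻¹) =
    ν.restrict {x | Real.cos (inner ℝ x v) ≠ 1} := by
  have hU : MeasurableSet {x : EuclideanSpace ℝ (Fin q) | Real.cos (inner ℝ x v) ≠ 1} := by
    refine (measurableSet_eq_fun (by fun_prop) measurable_const).compl
  have hd : (Measure.dirac 0).restrict
      {x : EuclideanSpace ℝ (Fin q) | Real.cos (inner ℝ x v) ≠ 1} = 0 :=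
    Measure.restrict_eq_zero.mpr (by rw [Measure.dirac_apply' _ hU]; simp)
  rw [symmDiffMeasure, Measure.restrict_add, Measure.restrict_smul, hd,
    smul_zero, zero_add, restrict_withDensity hU]
  refine withDensity_inv_same (measurable_ofReal_two_sub_cos v) ?_
    (ae_of_all _ fun _ => ENNReal.ofReal_ne_top)
  filter_upwards [ae_restrict_mem hU] with x hx
  rw [ne_eq, ENNReal.ofReal_eq_zero, not_le]
  have h1 : Real.cos (inner ℝ x v) < 1 := lt_of_le_of_ne (Real.cos_le_one _) hx
  linarith

/-- For `x_i ≠ 0` and `n > |x_i|`, the number `x_i / (n + 1)` is nonzero and within `(-2π, 2π)`.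
Hence countably many directions detect every nonzero `x`. -/
theorem exists_cos_inner_single_ne_one {x : EuclideanSpace ℝ (Fin q)} (hx : x ≠ 0) :
    ∃ (i : Fin q) (n : ℕ),
      Real.cos (inner ℝ x (EuclideanSpace.single i (1 / ((n : ℝ) + 1)))) ≠ 1 := by
  obtain ⟨i, hi⟩ : ∃ i, x i ≠ 0 := by
    by_contra! h
    exact hx (by ext i; simpa using h i)
  obtain ⟨n, hn⟩ := exists_nat_gt |x i|
  refine ⟨i, n, ?_⟩
  have hd : (0 : ℝ) < n + 1 := by positivity
  have h1 : |x i / (n + 1)| < 1 := by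
    rw [abs_div, abs_of_pos hd, div_lt_one hd]
    linarith
  have h2 := abs_lt.mp h1
  have hpi := Real.pi_gt_three
  rw [EuclideanSpace.inner_single_right]
  simp only [conj_trivial]
  rw [one_div_mul_eq_div, ne_eq, Real.cos_eq_one_iff_of_lt_of_lt (by linarith) (by linarith)]
  positivity

/-- The jump measure in the Lévy–Khintchine formula is unique. -/
theorem eq_of_levyExponent_eq {ν' : Measure (EuclideanSpace ℝ (Fin q))}
    (hν0 : ν {0} = 0) (hν0' : ν' {0} = 0)
    (hν : ∫⁻ x, ENNReal.ofReal (min 1 (‖x‖ ^ 2)) ∂ν < ∞)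
    (hν' : ∫⁻ x, ENNReal.ofReal (min 1 (‖x‖ ^ 2)) ∂ν' < ∞)
    {b b' : EuclideanSpace ℝ (Fin q)} {S S' : Matrix (Fin q) (Fin q) ℝ}
    (hS : S.PosSemidef) (hS' : S'.PosSemidef)
    (h : ∀ u, levyExponent b S ν u = levyExponent b' S' ν' u) : ν = ν' := by
  have h1 : ∀ v, symmDiffMeasure S ν v = symmDiffMeasure S' ν' v := by
    intro v
    have := isFiniteMeasure_symmDiffMeasure S hν v
    have := isFiniteMeasure_symmDiffMeasure S' hν' v
    refine Measure.ext_of_charFun (funext fun u => ?_)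
    rw [charFun_symmDiffMeasure hS hν b, charFun_symmDiffMeasure hS' hν' b', h, h, h]
  -- A countable cover: the index `none` gives `{0}`, which both measures neglect, and on every
  -- other member the density can be inverted.
  let s : Option (Fin q × ℕ) → Set (EuclideanSpace ℝ (Fin q)) := fun o => o.elim {0}
    fun p => {x | Real.cos (inner ℝ x (EuclideanSpace.single p.1 (1 / ((p.2 : ℝ) + 1)))) ≠ 1}
  have hs : ⋃ o, s o = Set.univ := by
    refine Set.eq_univ_of_forall fun x => ?_
    rw [Set.mem_iUnion]
    by_cases hx : x = 0
    · exact ⟨none, hx⟩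
    · obtain ⟨i, n, hin⟩ := exists_cos_inner_single_ne_one hx
      exact ⟨some (i, n), hin⟩
  refine Measure.ext_of_iUnion_eq_univ hs fun o => ?_
  cases o with
  | none =>
    change ν.restrict {0} = ν'.restrict {0}
    rw [Measure.restrict_eq_zero.mpr hν0, Measure.restrict_eq_zero.mpr hν0']
  | some p =>
    have h2 := restrict_symmDiffMeasure S ν
      (EuclideanSpace.single p.1 (1 / ((p.2 : ℝ) + 1)))
    rw [h1, restrict_symmDiffMeasure] at h2
    exact h2.symm

theorem IsLevyMeasure.unique {Ω : Type*} [MeasurableSpace Ω] {P : Measure Ω}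
    {X : ℝ≥0 → Ω → EuclideanSpace ℝ (Fin q)} {ν' : Measure (EuclideanSpace ℝ (Fin q))}
    (h : IsLevyMeasure P X ν) (h' : IsLevyMeasure P X ν') : ν = ν' := by
  obtain ⟨b, S, hS, hc⟩ := h.charFun_eq
  obtain ⟨b', S', hS', hc'⟩ := h'.charFun_eq
  refine eq_of_levyExponent_eq h.zero h'.zero h.lintegral_lt_top h'.lintegral_lt_top hS hS'
    (b := b) (b' := b') fun u => eq_of_forall_exp_mul_eq fun t => ?_
  rw [← hc, ← hc']

end LevyKhintchine

/-! ### Paths -/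

section Paths

/-- The path is right-continuous with left limits. -/
def IsCadlag {E : Type*} [TopologicalSpace E] (x : ℝ≥0 → E) : Prop :=
  ∀ t, ContinuousWithinAt x (Set.Ici t) t ∧ ∃ l, Tendsto x (𝓝[<] t) (𝓝 l)

/-- The path is nondecreasing and right-continuous. -/
structure IsClock (y : ℝ≥0 → ℝ≥0) : Prop where
  monotone : Monotone y
  rightCont : ∀ t, ContinuousWithinAt y (Set.Ici t) t

theorem IsClock.tendsto_nhdsGE {y : ℝ≥0 → ℝ≥0} (hy : IsClock y) (t : ℝ≥0) :
    Tendsto y (𝓝[≥] t) (𝓝[≥] (y t)) :=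
  tendsto_nhdsWithin_iff.mpr ⟨hy.rightCont t, by
    filter_upwards [self_mem_nhdsWithin] with s hs using hy.monotone hs⟩

theorem IsClock.comp {x y : ℝ≥0 → ℝ≥0} (hx : IsClock x) (hy : IsClock y) :
    IsClock fun t => x (y t) :=
  ⟨hx.monotone.comp hy.monotone, fun t => (hx.rightCont (y t)).tendsto.comp (hy.tendsto_nhdsGE t)⟩

/-- For the left limit at `t` there are two cases. Either `y` attains its left limit `l` before `t`
and then stays there, so the limit is `x l`; or `y` approaches `l` strictly from below and the left
limit of `x` at `l` applies. -/
theorem IsCadlag.comp_isClock {E : Type*} [TopologicalSpace E] {x : ℝ≥0 → E} (hx : IsCadlag x)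
    {y : ℝ≥0 → ℝ≥0} (hy : IsClock y) : IsCadlag fun t => x (y t) := by
  intro t
  refine ⟨(hx (y t)).1.tendsto.comp (hy.tendsto_nhdsGE t), ?_⟩
  have hl := hy.monotone.tendsto_nhdsLT t
  set l := sSup (y '' Set.Iio t)
  have hle : ∀ s < t, y s ≤ l := fun s hs =>
    le_csSup ⟨y t, by rintro _ ⟨r, hr, rfl⟩; exact hy.monotone (le_of_lt hr)⟩ ⟨s, hs, rfl⟩
  by_cases h : ∃ s < t, y s = l
  · obtain ⟨s, hs, hsl⟩ := h
    refine ⟨x l, tendsto_const_nhds.congr' ?_⟩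
    filter_upwards [Ioo_mem_nhdsLT hs] with r hr
    have : y r = l := le_antisymm (hle r hr.2) (hsl ▸ hy.monotone hr.1.le)
    rw [this]
  · push Not at h
    obtain ⟨m, hm⟩ := (hx l).2
    refine ⟨m, hm.comp (tendsto_nhdsWithin_iff.mpr ⟨hl, ?_⟩)⟩
    filter_upwards [self_mem_nhdsWithin] with s hs
    exact lt_of_le_of_ne (hle s hs) (h s hs)

/-- The least multiple of `1 / (n + 1)` that exceeds `s`. -/
def gridAbove (n : ℕ) (s : ℝ≥0) : ℝ≥0 := ((⌊((n : ℝ≥0) + 1) * s⌋₊ : ℝ≥0) + 1) / ((n : ℝ≥0) + 1)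

theorem gridAbove_mono (n : ℕ) : Monotone (gridAbove n) := by
  intro s t h
  unfold gridAbove
  gcongr

theorem lt_gridAbove (n : ℕ) (s : ℝ≥0) : s < gridAbove n s := by
  have hd : (0 : ℝ≥0) < n + 1 := by positivity
  rw [gridAbove, lt_div_iff₀ hd, mul_comm]
  exact Nat.lt_floor_add_one _

theorem gridAbove_le (n : ℕ) (s : ℝ≥0) : gridAbove n s ≤ s + 1 / ((n : ℝ≥0) + 1) := by
  have hd : (0 : ℝ≥0) < n + 1 := by positivity
  rw [gridAbove, add_div]
  gcongr
  rw [div_le_iff₀ hd, mul_comm]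
  exact Nat.floor_le (by positivity)

theorem tendsto_gridAbove (s : ℝ≥0) : Tendsto (fun n => gridAbove n s) atTop (𝓝[≥] s) := by
  refine tendsto_nhdsWithin_iff.mpr ⟨?_, Eventually.of_forall fun n => (lt_gridAbove n s).le⟩
  refine tendsto_of_tendsto_of_tendsto_of_le_of_le tendsto_const_nhds ?_
    (fun n => (lt_gridAbove n s).le) (fun n => gridAbove_le n s)
  have h := tendsto_one_div_add_atTop_nhds_zero_nat (𝕜 := ℝ≥0)
  simpa using tendsto_const_nhds (x := s).add h

/-- Right-continuity reduces monotonicity to countably many inequalities, each of which may fail on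
its own null set. -/
theorem monotone_of_grid {y : ℝ≥0 → ℝ≥0} (hy : ∀ t, ContinuousWithinAt y (Set.Ici t) t)
    (h : ∀ n m m' : ℕ, m ≤ m' → y (((m : ℝ≥0) + 1) / ((n : ℝ≥0) + 1)) ≤
      y (((m' : ℝ≥0) + 1) / ((n : ℝ≥0) + 1))) : Monotone y := by
  intro s t hst
  refine le_of_tendsto_of_tendsto' ((hy s).tendsto.comp (tendsto_gridAbove s))
    ((hy t).tendsto.comp (tendsto_gridAbove t)) fun n => h n _ _ ?_
  gcongr

variable {Ω : Type*} [MeasurableSpace Ω] {P : Measure Ω}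

/-- By stationarity the increment has the law of the nonnegative variable `X (t - s)`. -/
theorem IsLevyProcess.ae_le {X : ℝ≥0 → Ω → ℝ≥0}
    (hX : IsLevyProcess P fun t ω => (X t ω : ℝ)) {s t : ℝ≥0} (hst : s ≤ t) :
    ∀ᵐ ω ∂P, X s ω ≤ X t ω := by
  have h := (hX.stationary s (t - s)).symm.ae_snd (p := fun x : ℝ => 0 ≤ x) measurableSet_Ici
    (ae_of_all _ fun ω => (X (t - s) ω).2)
  filter_upwards [h] with ω hω
  rw [add_tsub_cancel_of_le hst, sub_nonneg] at hω
  exact_mod_cast hω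

/-- Almost all paths of a nonnegative Lévy process are nondecreasing. -/
theorem IsLevyProcess.ae_isClock {X : ℝ≥0 → Ω → ℝ≥0}
    (hX : IsLevyProcess P fun t ω => (X t ω : ℝ)) : ∀ᵐ ω ∂P, IsClock fun t => X t ω := by
  have h : ∀ᵐ ω ∂P, ∀ n m m' : ℕ, m ≤ m' → X (((m : ℝ≥0) + 1) / ((n : ℝ≥0) + 1)) ω ≤
      X (((m' : ℝ≥0) + 1) / ((n : ℝ≥0) + 1)) ω := by
    simp only [ae_all_iff]
    intro n m m' hm
    exact hX.ae_le (by gcongr)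
  filter_upwards [h, hX.cadlag] with ω h1 h2
  have h3 : ∀ t, ContinuousWithinAt (fun t => X t ω) (Set.Ici t) t := fun t =>
    NNReal.tendsto_coe.mp (h2 t).1
  exact ⟨monotone_of_grid h3 h1, h3⟩

theorem isLevy_coe_natCast {B : ℝ≥0 → Ω → ℕ} :
    (IsLevyProcess P fun t ω => (((B t ω : ℕ) : ℝ≥0) : ℝ)) ↔
      IsLevyProcess P fun t ω => (B t ω : ℝ) := by
  simp only [NNReal.coe_natCast]

theorem isClock_add_mul {lam : ℝ≥0} {b : ℝ≥0 → ℝ≥0} (hb : IsClock b) :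
    IsClock fun t => t + lam⁻¹ * b (lam * t) := by
  have h1 : IsClock fun t : ℝ≥0 => lam * t :=
    ⟨fun s t h => mul_le_mul_right h _, fun t => by fun_prop⟩
  have h2 := hb.comp h1
  refine ⟨fun s t h => add_le_add h (mul_le_mul_right (h2.monotone h) _), fun t => ?_⟩
  exact continuousWithinAt_id.add (continuousWithinAt_const.mul (h2.rightCont t))

end Paths

/-! ### Increments of Lévy processes -/

section Increments

variable {Ω : Type*} [MeasurableSpace Ω] {P : Measure Ω}

theorem IsLevyProcess.integral_prod_increments {E : Type*} [NormedAddCommGroup E]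
    [MeasurableSpace E] [MeasurableSub₂ E] {X : ℝ≥0 → Ω → E}
    (hX : IsLevyProcess P X) {n : ℕ} {t : Fin (n + 1) → ℝ≥0} (ht : Monotone t)
    {g : Fin n → E → ℂ} (hg : ∀ j, Measurable (g j)) :
    ∫ ω, ∏ j, g j (X (t j.succ) ω - X (t j.castSucc) ω) ∂P =
      ∏ j, ∫ ω, g j (X (t j.succ - t j.castSucc) ω) ∂P := by
  rw [iIndepFun.integral_fun_prod_comp (hX.indep n t ht)
    (fun j => (hX.aemeasurable _).sub (hX.aemeasurable _))
    (fun j => (hg j).aestronglyMeasurable)]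
  refine Finset.prod_congr rfl fun j _ => ?_
  have h := hX.stationary (t j.castSucc) (t j.succ - t j.castSucc)
  rw [add_tsub_cancel_of_le (ht j.castSucc_le_succ)] at h
  exact (h.comp (hg j)).integral_eq

variable {E : Type*} [NormedAddCommGroup E] [InnerProductSpace ℝ E] [MeasurableSpace E]
  [BorelSpace E] [SecondCountableTopology E] [CompleteSpace E]

/-- A process whose increments have jointly the characteristic function of independent increments
with exponent `Ψ` is a Lévy process. -/
theorem isLevy_of_integral_exp [IsProbabilityMeasure P] {W : ℝ≥0 → Ω → E} {Ψ : E → ℂ}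
    (hm : ∀ t, AEMeasurable (W t) P) (h0 : ∀ᵐ ω ∂P, W 0 ω = 0)
    (hc : ∀ᵐ ω ∂P, IsCadlag fun t => W t ω)
    (h : ∀ (n : ℕ) (t : Fin (n + 1) → ℝ≥0), Monotone t → ∀ u : Fin n → E,
      ∫ ω, ∏ j, Complex.exp
          ((inner ℝ (W (t j.succ) ω - W (t j.castSucc) ω) (u j) : ℝ) * Complex.I) ∂P =
        ∏ j, Complex.exp (((t j.succ : ℝ) - t j.castSucc : ℝ) * Ψ (u j))) :
    IsLevyProcess P W ∧ ∀ t u, charFun (P.map (W t)) u = Complex.exp ((t : ℝ) * Ψ u) := by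
  have hsub : ∀ s t, AEMeasurable (fun ω => W t ω - W s ω) P := fun s t => (hm t).sub (hm s)
  have hincr : ∀ s t : ℝ≥0, s ≤ t → ∀ u,
      charFun (P.map fun ω => W t ω - W s ω) u = Complex.exp (((t : ℝ) - s : ℝ) * Ψ u) := by
    intro s t hst u
    -- The partition with the single interval `[s, t]` gives the law of one increment.
    have := h 1 ![s, t] (by
      intro a b hab
      fin_cases a <;> fin_cases b <;> simp_all) fun _ => u
    rw [charFun_apply, integral_map (hsub s t) (by fun_prop)]
    simpa using this
  have hW0 : ∀ t, (fun ω => W t ω - W 0 ω) =ᵐ[P] W t := fun t => by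
    filter_upwards [h0] with ω hω
    rw [hω, sub_zero]
  have hchar : ∀ t u, charFun (P.map (W t)) u = Complex.exp ((t : ℝ) * Ψ u) := by
    intro t u
    rw [← Measure.map_congr (hW0 t), hincr 0 t zero_le]
    simp
  refine ⟨⟨hm, h0, ?_, ?_, hc⟩, hchar⟩
  · intro n t ht
    rw [iIndepFun_iff_charFun_pi fun j => hsub _ _]
    intro u
    have hpi : AEMeasurable (fun ω => WithLp.toLp 2
        fun j : Fin n => W (t j.succ) ω - W (t j.castSucc) ω) P :=
      (WithLp.measurable_toLp 2 _).comp_aemeasurable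
        (aemeasurable_pi_lambda _ fun j => hsub _ _)
    rw [charFun_apply, integral_map hpi (by fun_prop)]
    rw [Finset.prod_congr rfl fun j _ => hincr _ _ (ht j.castSucc_le_succ) (u j), ← h n t ht]
    refine integral_congr_ae (ae_of_all _ fun ω => ?_)
    simp only [PiLp.inner_apply]
    rw [← Complex.exp_sum, ← Finset.sum_mul]
    push_cast
    rfl
  · intro s t
    refine ⟨hsub _ _, hm _, ?_⟩
    have := Measure.isProbabilityMeasure_map (μ := P) (hm t)
    have := Measure.isProbabilityMeasure_map (μ := P) (hsub s (s + t))
    refine Measure.ext_of_charFun (funext fun u => ?_)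
    rw [hchar, hincr s (s + t) le_self_add]
    simp

end Increments

/-! ### Evaluation at independent random times -/

section RandomTimes

variable {Ω : Type*} [MeasurableSpace Ω] {P : Measure Ω}

theorem measurable_comp_countable {S E : Type*} [Countable S] [MeasurableSpace S]
    [MeasurableSingletonClass S] [MeasurableSpace E] {N : Ω → S} (hN : Measurable N)
    {X : S → Ω → E} (hX : ∀ s, Measurable (X s)) : Measurable fun ω => X (N ω) ω :=
  (measurable_from_prod_countable_right (f := fun p : S × Ω => X p.1 p.2) hX).comp
    (hN.prodMk measurable_id)

/-- Countability of `S` gives joint measurability of `F` from measurability in the second variable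
alone. This is why random times are first rounded to a grid: evaluating a path at an arbitrary real
time is not jointly measurable on the product space of paths. -/
theorem integral_comp_indep_countable [IsProbabilityMeasure P] {S α : Type*} [Countable S]
    [MeasurableSpace S] [MeasurableSingletonClass S] [MeasurableSpace α] {X : Ω → α} {N : Ω → S}
    (hX : Measurable X) (hN : Measurable N) (h : IndepFun X N P) {F : S → α → ℂ}
    (hF : ∀ s, Measurable (F s)) (hb : ∀ s x, ‖F s x‖ ≤ 1) :
    ∫ ω, F (N ω) (X ω) ∂P = ∫ ω, ∫ ω', F (N ω) (X ω') ∂P ∂P := by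
  have hFm : Measurable fun p : S × α => F p.1 p.2 := measurable_from_prod_countable_right hF
  have hmap := h.symm.map_prod_eq_prod_map_map hN.aemeasurable hX.aemeasurable
  have := Measure.isProbabilityMeasure_map (μ := P) hX.aemeasurable
  have := Measure.isProbabilityMeasure_map (μ := P) hN.aemeasurable
  calc ∫ ω, F (N ω) (X ω) ∂P
      = ∫ p, F p.1 p.2 ∂(P.map fun ω => (N ω, X ω)) :=
        (integral_map (hN.prodMk hX).aemeasurable hFm.aestronglyMeasurable).symm
    _ = ∫ s, ∫ x, F s x ∂(P.map X) ∂(P.map N) := by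
        rw [hmap, integral_prod _
          (Integrable.of_bound hFm.aestronglyMeasurable 1 (ae_of_all _ fun p => hb _ _))]
    _ = ∫ ω, ∫ x, F (N ω) x ∂(P.map X) ∂P :=
        integral_map hN.aemeasurable Measurable.of_discrete.aestronglyMeasurable
    _ = ∫ ω, ∫ ω', F (N ω) (X ω') ∂P ∂P := by
        refine integral_congr_ae (ae_of_all _ fun ω => ?_)
        exact integral_map hX.aemeasurable (hF _).aestronglyMeasurable

theorem norm_prod_prod_le_one {ι κ : Type*} [Fintype ι] [Fintype κ] {f : ι → κ → ℂ}
    (h : ∀ i j, ‖f i j‖ ≤ 1) : ‖∏ i, ∏ j, f i j‖ ≤ 1 := by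
  simp only [norm_prod]
  exact Finset.prod_le_one (fun _ _ => Finset.prod_nonneg fun _ _ => norm_nonneg _)
    fun i _ => Finset.prod_le_one (fun _ _ => norm_nonneg _) fun j _ => h i j

theorem norm_exp_nnreal_mul_le_one (x : ℝ≥0) {w : ℂ} (hw : w.re ≤ 0) :
    ‖Complex.exp (((x : ℝ) : ℂ) * w)‖ ≤ 1 := by
  rw [Complex.norm_exp, Complex.re_ofReal_mul, Real.exp_le_one_iff]
  exact mul_nonpos_of_nonneg_of_nonpos x.2 hw

/-- Nondecreasing right-continuous processes `T_1, …, T_q` with jointly stationary and independent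
increments, whose joint Laplace exponent is `Φ`. The differences are truncated at `0`. -/
structure IsJointSubordinator {q : ℕ} (P : Measure Ω) (T : Fin q → ℝ≥0 → Ω → ℝ≥0)
    (Φ : (Fin q → ℂ) → ℂ) : Prop where
  measurable : ∀ i t, Measurable (T i t)
  zero : ∀ i, ∀ᵐ ω ∂P, T i 0 ω = 0
  clock : ∀ i, ∀ᵐ ω ∂P, IsClock fun t => T i t ω
  laplace : ∀ (n : ℕ) (t : Fin (n + 1) → ℝ≥0), Monotone t → ∀ w : Fin q → Fin n → ℂ,
    (∀ i j, (w i j).re ≤ 0) →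
      ∫ ω, ∏ i, ∏ j, Complex.exp
        (((T i (t j.succ) ω - T i (t j.castSucc) ω : ℝ≥0) : ℝ) * w i j) ∂P =
      ∏ j, Complex.exp (((t j.succ : ℝ) - t j.castSucc : ℝ) * Φ fun i => w i j)

variable {q : ℕ} {k : Fin q → ℕ} {r : (i : Fin q) → Fin (k i) → ℝ} {M : Fin q → ℝ≥0 → Ω → ℕ}

theorem measurable_path {E : Type*} [MeasurableSpace E] {X : Fin q → ℝ≥0 → Ω → E}
    (h : ∀ i t, Measurable (X i t)) : Measurable fun ω i t => X i t ω :=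
  measurable_pi_lambda _ fun i => measurable_pi_lambda _ fun t => h i t

/-- The deterministic times may differ between components, because they stand for the values of
`T_1, …, T_q` on which one conditions. -/
theorem integral_exp_gcp [IsProbabilityMeasure P] (hr : ∀ i j, 0 < r i j)
    (hM : ∀ i, IsGCP P (r i) (M i)) (hMindep : iIndepFun (fun i ω t => M i t ω) P) {n : ℕ}
    {s : Fin q → Fin (n + 1) → ℝ≥0} (hs : ∀ i, Monotone (s i)) (u : Fin q → Fin n → ℝ) :
    ∫ ω, ∏ i, ∏ j, Complex.exp (Complex.I *
        ((u i j * ((M i (s i j.succ) ω : ℝ) - M i (s i j.castSucc) ω) : ℝ) : ℂ)) ∂P =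
      ∏ i, ∏ j, Complex.exp (((s i j.succ - s i j.castSucc : ℝ≥0) : ℝ)
        * gcpExponent (r i) (u i j)) := by
  have h1 := iIndepFun.integral_fun_prod_comp (𝕜 := ℂ) hMindep
    (f := fun i (x : ℝ≥0 → ℕ) => ∏ j, Complex.exp (Complex.I *
        ((u i j * ((x (s i j.succ) : ℝ) - x (s i j.castSucc)) : ℝ) : ℂ)))
    (fun i => (measurable_pi_lambda _ fun t => (hM i).measurable t).aemeasurable)
    (fun i => by
      refine Measurable.aestronglyMeasurable (Finset.measurable_prod _ fun j _ => ?_)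
      fun_prop)
  rw [h1]
  refine Finset.prod_congr rfl fun i _ => ?_
  have h2 := (IsGCP.isLevyProcess (hM i)).integral_prod_increments (hs i)
    (g := fun j x => Complex.exp (Complex.I * ((u i j * x : ℝ) : ℂ))) fun j => by fun_prop
  rw [h2]
  exact Finset.prod_congr rfl fun j _ => (hM i).integral_exp (hr i) _ _

variable {T : Fin q → ℝ≥0 → Ω → ℝ≥0} {Φ : (Fin q → ℂ) → ℂ}

theorem ae_tendsto_gridAbove_gcp (hM : ∀ i, IsGCP P (r i) (M i)) (i : Fin q) (t : ℝ≥0) :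
    ∀ᵐ ω ∂P, Tendsto (fun m => (M i (gridAbove m (T i t ω)) ω : ℝ)) atTop
      (𝓝 (M i (T i t ω) ω : ℝ)) := by
  filter_upwards [(IsGCP.isLevyProcess (hM i)).cadlag] with ω hω
  exact (hω (T i t ω)).1.tendsto.comp (tendsto_gridAbove _)

theorem measurable_gcp_gridAbove (hM : ∀ i, IsGCP P (r i) (M i))
    (hT : ∀ i t, Measurable (T i t)) (i : Fin q) (t : ℝ≥0) (m : ℕ) :
    Measurable fun ω => (M i (gridAbove m (T i t ω)) ω : ℝ) := by
  have hN : Measurable fun ω => ⌊((m : ℝ≥0) + 1) * T i t ω⌋₊ :=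
    Nat.measurable_floor.comp ((hT i t).const_mul _)
  exact measurable_comp_countable hN
    (X := fun (N : ℕ) ω => (M i (((N : ℝ≥0) + 1) / ((m : ℝ≥0) + 1)) ω : ℝ))
    fun N => measurable_from_top.comp ((hM i).measurable _)

/-- Rounding times up to a grid gives measurable approximations; they converge only almost surely,
since only almost all paths are right-continuous. -/
theorem aemeasurable_gcp_comp (hM : ∀ i, IsGCP P (r i) (M i))
    (hT : ∀ i t, Measurable (T i t)) (i : Fin q) (t : ℝ≥0) :
    AEMeasurable (fun ω => (M i (T i t ω) ω : ℝ)) P :=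
  aemeasurable_of_tendsto_metrizable_ae atTop
    (fun m => (measurable_gcp_gridAbove hM hT i t m).aemeasurable)
    (ae_tendsto_gridAbove_gcp hM i t)

/-- The joint characteristic function of the increments of a time-changed family of independent
generalized counting processes. -/
theorem integral_exp_gcp_comp [IsProbabilityMeasure P] (hr : ∀ i j, 0 < r i j)
    (hM : ∀ i, IsGCP P (r i) (M i)) (hMindep : iIndepFun (fun i ω t => M i t ω) P)
    (hT : IsJointSubordinator P T Φ)
    (hMT : IndepFun (fun ω i t => M i t ω) (fun ω i t => T i t ω) P) {n : ℕ}
    {t : Fin (n + 1) → ℝ≥0} (ht : Monotone t) (u : Fin q → Fin n → ℝ) :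
    ∫ ω, ∏ i, ∏ j, Complex.exp (Complex.I * ((u i j *
        ((M i (T i (t j.succ) ω) ω : ℝ) - M i (T i (t j.castSucc) ω) ω) : ℝ) : ℂ)) ∂P =
      ∏ j, Complex.exp (((t j.succ : ℝ) - t j.castSucc : ℝ)
        * Φ fun i => gcpExponent (r i) (u i j)) := by
  have hψ : ∀ i j, (gcpExponent (r i) (u i j)).re ≤ 0 := fun i j =>
    gcpExponent_re_nonpos (hr i) _
  rw [← hT.laplace n t ht (fun i j => gcpExponent (r i) (u i j)) hψ]
  have hclock : ∀ᵐ ω ∂P, ∀ i, IsClock fun t => T i t ω := ae_all_iff.mpr hT.clock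
  -- the formula along the grid
  have hgrid : ∀ m : ℕ, ∫ ω, ∏ i, ∏ j, Complex.exp (Complex.I * ((u i j *
        ((M i (gridAbove m (T i (t j.succ) ω)) ω : ℝ)
          - M i (gridAbove m (T i (t j.castSucc) ω)) ω) : ℝ) : ℂ)) ∂P =
      ∫ ω, ∏ i, ∏ j, Complex.exp (((gridAbove m (T i (t j.succ) ω)
        - gridAbove m (T i (t j.castSucc) ω) : ℝ≥0) : ℝ) * gcpExponent (r i) (u i j)) ∂P := by
    intro m
    -- The rounded times are determined by finitely many integers, so one can condition on a
    -- countable variable.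
    let N : Ω → Fin q → Fin (n + 1) → ℕ := fun ω i j => ⌊((m : ℝ≥0) + 1) * T i (t j) ω⌋₊
    let F : (Fin q → Fin (n + 1) → ℕ) → (Fin q → ℝ≥0 → ℕ) → ℂ := fun N x =>
      ∏ i, ∏ j, Complex.exp (Complex.I * ((u i j *
        ((x i (((N i (Fin.succ j) : ℝ≥0) + 1) / ((m : ℝ≥0) + 1)) : ℝ)
          - x i (((N i (Fin.castSucc j) : ℝ≥0) + 1) / ((m : ℝ≥0) + 1))) : ℝ) : ℂ))
    have hNpath : Measurable fun (y : Fin q → ℝ≥0 → ℝ≥0) (i : Fin q) (j : Fin (n + 1)) =>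
        ⌊((m : ℝ≥0) + 1) * y i (t j)⌋₊ :=
      measurable_pi_lambda _ fun i => measurable_pi_lambda _ fun j =>
        Nat.measurable_floor.comp (by fun_prop)
    have hind : IndepFun (fun ω i t => M i t ω) N P := hMT.comp measurable_id hNpath
    have h1 := integral_comp_indep_countable
      (measurable_path fun i t => (hM i).measurable t)
      (hNpath.comp (measurable_path hT.measurable)) hind (F := F)
      (fun s => Finset.measurable_prod _ fun i _ => Finset.measurable_prod _ fun j _ => by fun_prop)
      (fun s x => norm_prod_prod_le_one fun i j => norm_exp_I_mul_le _)
    refine h1.trans (integral_congr_ae ?_)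
    filter_upwards [hclock] with ω hω
    exact integral_exp_gcp hr hM hMindep (s := fun i j => gridAbove m (T i (t j) ω))
      (fun i => (gridAbove_mono m).comp ((hω i).monotone.comp ht)) u
  -- Refine the grid by dominated convergence: the left side converges by right-continuity of `M`,
  -- the right side by continuity of the exponential.
  refine tendsto_nhds_unique (f := fun m : ℕ => ∫ ω, ∏ i, ∏ j, Complex.exp (Complex.I * ((u i j *
        ((M i (gridAbove m (T i (t j.succ) ω)) ω : ℝ)
          - M i (gridAbove m (T i (t j.castSucc) ω)) ω) : ℝ) : ℂ)) ∂P) (l := atTop) ?_ ?_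
  · refine tendsto_integral_of_dominated_convergence (fun _ => 1) (fun m => ?_)
      (integrable_const _) (fun m => ae_of_all _ fun ω => ?_) ?_
    · have := measurable_gcp_gridAbove hM hT.measurable
      refine Measurable.aestronglyMeasurable (Finset.measurable_prod _ fun i _ =>
        Finset.measurable_prod _ fun j _ => Complex.measurable_exp.comp
          (Measurable.const_mul (Complex.measurable_ofReal.comp
            (((this _ _ _).sub (this _ _ _)).const_mul _)) _))
    · exact norm_prod_prod_le_one fun i j => norm_exp_I_mul_le _
    · have h : ∀ᵐ ω ∂P, ∀ i (j : Fin (n + 1)),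
          Tendsto (fun m => (M i (gridAbove m (T i (t j) ω)) ω : ℝ)) atTop
            (𝓝 (M i (T i (t j) ω) ω : ℝ)) := by
        simp only [ae_all_iff]
        exact fun i j => ae_tendsto_gridAbove_gcp hM i (t j)
      filter_upwards [h] with ω hω
      refine tendsto_finsetProd _ fun i _ => tendsto_finsetProd _ fun j _ => ?_
      have h1 := ((hω i j.succ).sub (hω i j.castSucc)).const_mul (u i j)
      have hc : Continuous fun x : ℝ => Complex.exp (Complex.I * (x : ℂ)) := by fun_prop
      exact (hc.tendsto _).comp h1
  · simp only [hgrid]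
    refine tendsto_integral_of_dominated_convergence (fun _ => 1) (fun m => ?_)
      (integrable_const _) (fun m => ae_of_all _ fun ω => ?_) (ae_of_all _ fun ω => ?_)
    · have : ∀ i s, Measurable fun ω => gridAbove m (T i s ω) := fun i s =>
        (gridAbove_mono m).measurable.comp (hT.measurable i s)
      refine Measurable.aestronglyMeasurable (Finset.measurable_prod _ fun i _ =>
        Finset.measurable_prod _ fun j _ => Complex.measurable_exp.comp
          (Measurable.mul_const (Complex.measurable_ofReal.comp
            (measurable_coe_nnreal_real.comp ((this _ _).sub (this _ _)))) _))
    · exact norm_prod_prod_le_one fun i j => norm_exp_nnreal_mul_le_one _ (hψ i j)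
    · refine tendsto_finsetProd _ fun i _ => tendsto_finsetProd _ fun j _ => ?_
      have h : ∀ s, Tendsto (fun m => gridAbove m (T i s ω)) atTop (𝓝 (T i s ω)) := fun s =>
        (tendsto_gridAbove _).mono_right nhdsWithin_le_nhds
      have hc : Continuous fun x : ℝ≥0 =>
          Complex.exp (((x : ℝ) : ℂ) * gcpExponent (r i) (u i j)) := by fun_prop
      exact (hc.tendsto _).comp ((h _).sub (h _))

/-- A family of independent generalized counting processes, run along an independent joint
subordinator, is a Lévy process. -/
theorem isLevy_timeChange [IsProbabilityMeasure P] (hr : ∀ i j, 0 < r i j)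
    (hM : ∀ i, IsGCP P (r i) (M i)) (hMindep : iIndepFun (fun i ω t => M i t ω) P)
    (hT : IsJointSubordinator P T Φ)
    (hMT : IndepFun (fun ω i t => M i t ω) (fun ω i t => T i t ω) P) :
    IsLevyProcess P (timeChange M T) ∧ ∀ (t : ℝ≥0) (u : EuclideanSpace ℝ (Fin q)),
      charFun (P.map (timeChange M T t)) u =
        Complex.exp ((t : ℝ) * Φ fun i => gcpExponent (r i) (u i)) := by
  let Ψ : EuclideanSpace ℝ (Fin q) → ℂ := fun u => Φ fun i => gcpExponent (r i) (u i)
  refine isLevy_of_integral_exp (W := timeChange M T) (Ψ := Ψ) (fun t => ?_) ?_ ?_ ?_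
  · exact (WithLp.measurable_toLp 2 _).comp_aemeasurable
      (aemeasurable_pi_lambda _ fun i => aemeasurable_gcp_comp hM hT.measurable i t)
  · filter_upwards [ae_all_iff.mpr hT.zero, ae_all_iff.mpr fun i => (IsGCP.isLevyProcess (hM i)).zero]
      with ω h1 h2
    ext i
    simp [timeChange, h1 i]
    simpa using h2 i
  · filter_upwards [ae_all_iff.mpr hT.clock, ae_all_iff.mpr fun i => (IsGCP.isLevyProcess (hM i)).cadlag]
      with ω h1 h2
    have h3 : ∀ i, IsCadlag fun t => (M i (T i t ω) ω : ℝ) := fun i =>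
      IsCadlag.comp_isClock (x := fun t => (M i t ω : ℝ)) (h2 i) (h1 i)
    intro t
    choose l hl using fun i => (h3 i t).2
    have hc : Continuous fun x : Fin q → ℝ => WithLp.toLp 2 x := PiLp.continuous_toLp 2 _
    refine ⟨(hc.tendsto _).comp (tendsto_pi_nhds.mpr fun i => (h3 i t).1.tendsto),
      WithLp.toLp 2 l, (hc.tendsto _).comp (tendsto_pi_nhds.mpr hl)⟩
  · intro n t ht u
    rw [← integral_exp_gcp_comp hr hM hMindep hT hMT ht fun i j => u j i]
    refine integral_congr_ae (ae_of_all _ fun ω => ?_)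
    simp only
    rw [Finset.prod_comm]
    refine Finset.prod_congr rfl fun j _ => ?_
    rw [← Complex.exp_sum, PiLp.inner_apply, ← Finset.mul_sum, mul_comm]
    congr 2
    push_cast
    refine Finset.sum_congr rfl fun i _ => ?_
    simp [timeChange]

end RandomTimes

/-! ### The gamma subordinators -/

section Subordinators

variable {Ω : Type*} [MeasurableSpace Ω] {P : Measure Ω} {q : ℕ} {lam : ℝ≥0} {a : Fin q → ℝ}
  {Z : Fin q → ℝ≥0 → Ω → ℝ≥0} {B : ℝ≥0 → Ω → ℕ} {θ : ℝ}

/-- The joint Laplace exponent of independent gamma processes. -/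
def gammaExponent (lam : ℝ≥0) (a : Fin q → ℝ) (w : Fin q → ℂ) : ℂ :=
  -((lam : ℝ) * ∑ i, Complex.log (1 - w i / a i))

/-- The joint Laplace exponent of independent gamma processes run along a common negative binomial
clock with drift. -/
def clockExponent (lam : ℝ≥0) (θ : ℝ) (a : Fin q → ℝ) (w : Fin q → ℂ) : ℂ :=
  gammaExponent lam a w
    + (lam : ℝ) * negBinExponent θ (Complex.exp (gammaExponent lam a w / (lam : ℝ)))

/-- Since `|1 - w_i / a_i| ≥ 1`, each logarithm has nonnegative real part. Hence `exp(γ / λ)` lies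
in the closed disc, as the negative binomial generating function requires. -/
theorem gammaExponent_re_nonpos (ha : ∀ i, 0 < a i) {w : Fin q → ℂ} (hw : ∀ i, (w i).re ≤ 0) :
    (gammaExponent lam a w).re ≤ 0 := by
  rw [gammaExponent, Complex.neg_re, Complex.re_ofReal_mul, Complex.re_sum, neg_nonpos]
  refine mul_nonneg lam.2 (Finset.sum_nonneg fun i _ => ?_)
  rw [Complex.log_re]
  refine Real.log_nonneg ?_
  have h1 : (1 - w i / a i).re = 1 - (w i).re / a i := by simp
  refine le_trans ?_ (Complex.re_le_norm _)
  rw [h1]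
  have := div_nonpos_of_nonpos_of_nonneg (hw i) (ha i).le
  linarith

theorem norm_exp_div_le_one {z : ℂ} (hz : z.re ≤ 0) (x : ℝ≥0) :
    ‖Complex.exp (z / (x : ℝ))‖ ≤ 1 := by
  rw [Complex.norm_exp, Complex.div_ofReal_re, Real.exp_le_one_iff]
  exact div_nonpos_of_nonpos_of_nonneg hz x.2

theorem IsGammaProcess.integral_exp [IsProbabilityMeasure P] (hlam : 0 < lam) {b : ℝ} (hb : 0 < b)
    {Y : ℝ≥0 → Ω → ℝ≥0} (hY : IsGammaProcess P lam b Y) (s : ℝ≥0) {w : ℂ} (hw : w.re ≤ 0) :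
    ∫ ω, Complex.exp (((Y s ω : ℝ) : ℂ) * w) ∂P =
      Complex.exp (-(((lam * s : ℝ≥0) : ℝ) * Complex.log (1 - w / b))) := by
  -- The gamma law is prescribed only for positive times; at time `0` the process vanishes almost
  -- surely.
  rcases eq_or_ne s 0 with rfl | hs
  · have h : (fun ω => Complex.exp (((Y 0 ω : ℝ) : ℂ) * w)) =ᵐ[P] fun _ => 1 := by
      filter_upwards [hY.isLevyProcess.zero] with ω hω
      rw [hω]
      simp
    rw [integral_congr_ae h]
    simp
  · have hs' : 0 < s := pos_iff_ne_zero.mpr hs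
    have hm : Measurable fun ω => (Y s ω : ℝ) := (hY.measurable s).coe_nnreal_real
    have h := integral_map (μ := P) (f := fun x : ℝ => Complex.exp (w * x)) hm.aemeasurable
      (by fun_prop : Measurable fun x : ℝ => Complex.exp (w * x)).aestronglyMeasurable
    rw [hY.law s hs', integral_cexp_gammaMeasure (mul_pos (by exact_mod_cast hlam)
      (by exact_mod_cast hs')) hb (hw.trans_lt hb)] at h
    simp only [mul_comm _ w]
    rw [← h]
    push_cast
    rfl

theorem isJointSubordinator_gamma [IsProbabilityMeasure P] (hlam : 0 < lam) (ha : ∀ i, 0 < a i)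
    (hZ : ∀ i, IsGammaProcess P lam (a i) (Z i))
    (hZindep : iIndepFun (fun i ω t => Z i t ω) P) :
    IsJointSubordinator P Z (gammaExponent lam a) where
  measurable i t := (hZ i).measurable t
  zero i := by
    filter_upwards [(IsGammaProcess.isLevyProcess (hZ i)).zero] with ω hω
    exact_mod_cast hω
  clock i := (IsGammaProcess.isLevyProcess (hZ i)).ae_isClock
  laplace n t ht w hw := by
    have h1 := iIndepFun.integral_fun_prod_comp (𝕜 := ℂ) hZindep
      (f := fun i (x : ℝ≥0 → ℝ≥0) => ∏ j : Fin n, Complex.exp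
        (((x (t j.succ) - x (t j.castSucc) : ℝ≥0) : ℝ) * w i j))
      (fun i => (measurable_pi_lambda _ fun t => (hZ i).measurable t).aemeasurable)
      (fun i => by
        refine Measurable.aestronglyMeasurable (Finset.measurable_prod _ fun j _ => ?_)
        fun_prop)
    rw [h1]
    have h2 : ∀ i, ∫ ω, ∏ j : Fin n, Complex.exp
        (((Z i (t j.succ) ω - Z i (t j.castSucc) ω : ℝ≥0) : ℝ) * w i j) ∂P =
        ∏ j : Fin n, Complex.exp (-(((lam * (t j.succ - t j.castSucc) : ℝ≥0) : ℝ)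
          * Complex.log (1 - w i j / a i))) := by
      intro i
      have h3 := (IsGammaProcess.isLevyProcess (hZ i)).integral_prod_increments ht
        (g := fun j x => Complex.exp ((x : ℂ) * w i j)) fun j => by fun_prop
      rw [Finset.prod_congr rfl fun j _ => (hZ i).integral_exp hlam (ha i) _ (hw i j)] at h3
      rw [← h3]
      refine integral_congr_ae ?_
      -- Almost sure monotonicity makes the truncated difference equal to the real one.
      have h4 : ∀ᵐ ω ∂P, ∀ j : Fin n, Z i (t j.castSucc) ω ≤ Z i (t j.succ) ω :=
        ae_all_iff.mpr fun j => (IsGammaProcess.isLevyProcess (hZ i)).ae_le (ht j.castSucc_le_succ)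
      filter_upwards [h4] with ω hω
      refine Finset.prod_congr rfl fun j _ => ?_
      rw [NNReal.coe_sub (hω j)]
    rw [Finset.prod_congr rfl fun i _ => h2 i, Finset.prod_comm]
    refine Finset.prod_congr rfl fun j _ => ?_
    rw [← Complex.exp_sum, NNReal.coe_mul, NNReal.coe_sub (ht j.castSucc_le_succ), gammaExponent,
      Finset.sum_neg_distrib, ← Finset.mul_sum]
    push_cast
    ring_nf

theorem measurable_gammaSubordinator (hZ : ∀ i t, Measurable (Z i t)) (hB : ∀ t, Measurable (B t))
    (i : Fin q) (t : ℝ≥0) : Measurable (gammaSubordinator lam Z B i t) :=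
  measurable_comp_countable (hB (lam * t)) (X := fun (N : ℕ) ω => Z i (t + lam⁻¹ * (N : ℝ≥0)) ω)
    fun _ => hZ i _

/-- Given `B`, the times `t_j + B(λ t_j) / λ` are deterministic and nondecreasing, so the gamma
formula yields `exp(Δt · γ) · exp(ΔB · γ / λ)` on each interval. Averaging over `B` evaluates its
generating function at `exp(γ / λ)` over a time `λ Δt`. -/
theorem isJointSubordinator_gammaSubordinator [IsProbabilityMeasure P] (hlam : 0 < lam)
    (hθ0 : 0 < θ) (hθ1 : θ < 1) (ha : ∀ i, 0 < a i)
    (hZ : ∀ i, IsGammaProcess P lam (a i) (Z i))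
    (hB : IsNegBinProcess P θ B)
    (hZindep : iIndepFun (fun i ω t => Z i t ω) P)
    (hZB : IndepFun (fun ω i t => Z i t ω) (fun ω t => B t ω) P) :
    IsJointSubordinator P (gammaSubordinator lam Z B) (clockExponent lam θ a) where
  measurable := measurable_gammaSubordinator (fun i => (hZ i).measurable) hB.measurable
  zero i := by
    filter_upwards [(IsGammaProcess.isLevyProcess (hZ i)).zero, hB.isLevyProcess.zero] with ω h1 h2
    have h3 : B 0 ω = 0 := by exact_mod_cast h2
    have h4 : Z i 0 ω = 0 := by exact_mod_cast h1
    simp [gammaSubordinator, h3, h4]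
  clock i := by
    filter_upwards [(IsGammaProcess.isLevyProcess (hZ i)).ae_isClock,
      (isLevy_coe_natCast.mpr hB.isLevyProcess).ae_isClock] with ω h1 h2
    exact h1.comp (isClock_add_mul (lam := lam) h2)
  laplace n t ht w hw := by
    have hZsub := isJointSubordinator_gamma hlam ha hZ hZindep
    have hlam' : ((lam : ℝ) : ℂ) ≠ 0 := by exact_mod_cast hlam.ne'
    let c : (Fin (n + 1) → ℕ) → Fin (n + 1) → ℝ≥0 := fun N j => t j + lam⁻¹ * (N j : ℝ≥0)
    let N : Ω → Fin (n + 1) → ℕ := fun ω j => B (lam * t j) ω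
    have hNpath : Measurable fun (y : ℝ≥0 → ℕ) (j : Fin (n + 1)) => y (lam * t j) :=
      measurable_pi_lambda _ fun j => measurable_pi_apply _
    have h1 := integral_comp_indep_countable
      (measurable_path fun i t => (hZ i).measurable t)
      (hNpath.comp (measurable_pi_lambda _ fun t => hB.measurable t))
      (hZB.comp measurable_id hNpath)
      (F := fun N (z : Fin q → ℝ≥0 → ℝ≥0) => ∏ i, ∏ j : Fin n, Complex.exp
        (((z i (c N j.succ) - z i (c N j.castSucc) : ℝ≥0) : ℝ) * w i j))
      (fun s => Finset.measurable_prod _ fun i _ => Finset.measurable_prod _ fun j _ => by fun_prop)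
      (fun s x => norm_prod_prod_le_one fun i j => norm_exp_nnreal_mul_le_one _ (hw i j))
    refine h1.trans ?_
    set gam : Fin n → ℂ := fun j => gammaExponent lam a fun i => w i j with hgam
    have hgre : ∀ j, (gam j).re ≤ 0 := fun j => gammaExponent_re_nonpos ha fun i => hw i j
    have hlt : Monotone fun j => lam * t j := fun i j h => mul_le_mul_right (ht h) _
    have h2 : ∀ᵐ ω ∂P, ∫ ω', ∏ i, ∏ j : Fin n, Complex.exp
        (((Z i (c (N ω) j.succ) ω' - Z i (c (N ω) j.castSucc) ω' : ℝ≥0) : ℝ) * w i j) ∂P =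
        (∏ j : Fin n, Complex.exp (((t j.succ : ℝ) - t j.castSucc : ℝ) * gam j)) *
        ∏ j : Fin n, Complex.exp ((((B (lam * t j.succ) ω : ℝ) - B (lam * t j.castSucc) ω : ℝ) : ℂ)
          * (gam j / (lam : ℝ))) := by
      filter_upwards [(isLevy_coe_natCast.mpr hB.isLevyProcess).ae_isClock] with ω hω
      have hc : Monotone (c (N ω)) := fun i j hij =>
        add_le_add (ht hij) (mul_le_mul_right (hω.monotone (hlt hij)) _)
      rw [hZsub.laplace n _ hc w hw, ← Finset.prod_mul_distrib]
      refine Finset.prod_congr rfl fun j _ => ?_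
      rw [← Complex.exp_add]
      congr 1
      simp only [c, N]
      push_cast
      field_simp
      ring
    refine (integral_congr_ae h2).trans ?_
    have h3 := hB.isLevyProcess.integral_prod_increments hlt
      (g := fun j x => Complex.exp ((x : ℂ) * (gam j / (lam : ℝ)))) fun j => by fun_prop
    rw [integral_const_mul, h3, ← Finset.prod_mul_distrib]
    refine Finset.prod_congr rfl fun j _ => ?_
    have h4 := hB.integral_pow hθ0 hθ1 (lam * t j.succ - lam * t j.castSucc)
      (norm_exp_div_le_one (hgre j) lam)
    simp only [← Complex.exp_nat_mul] at h4
    simp only [Complex.ofReal_natCast]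
    rw [h4, ← Complex.exp_add, NNReal.coe_sub (hlt j.castSucc_le_succ), clockExponent]
    congr 1
    push_cast
    ring

end Subordinators

/-! ### The Lévy measures -/

section Coefficients

variable {k : ℕ} {a : ℝ} {r : Fin k → ℝ}

theorem norm_sum_mul_pow_lt_one (ha : 0 < a) (hr : ∀ j, 0 < r j) {e : ℂ} (he : ‖e‖ ≤ 1) :
    ‖∑ j, ((r j / (a + ∑ l, r l) : ℝ) : ℂ) * e ^ ((j : ℕ) + 1)‖ < 1 := by
  have hs : 0 ≤ ∑ l, r l := Finset.sum_nonneg fun l _ => (hr l).le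
  have hd : 0 < a + ∑ l, r l := by linarith
  calc ‖∑ j, ((r j / (a + ∑ l, r l) : ℝ) : ℂ) * e ^ ((j : ℕ) + 1)‖
      ≤ ∑ j, r j / (a + ∑ l, r l) := by
        refine (norm_sum_le _ _).trans (Finset.sum_le_sum fun j _ => ?_)
        have h0 : 0 ≤ r j / (a + ∑ l, r l) := div_nonneg (hr j).le hd.le
        rw [norm_mul, norm_pow, Complex.norm_of_nonneg h0]
        exact mul_le_of_le_one_right h0 (pow_le_one₀ (norm_nonneg _) he)
    _ < 1 := by
        rw [← Finset.sum_div, div_lt_one hd]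
        linarith

theorem sum_div_add_sum_lt_one (ha : 0 < a) (hr : ∀ j, 0 < r j) :
    ∑ j, r j / (a + ∑ l, r l) < 1 := by
  have hs : 0 ≤ ∑ l, r l := Finset.sum_nonneg fun l _ => (hr l).le
  rw [← Finset.sum_div, div_lt_one (by linarith)]
  linarith

theorem sum_div_add_sum_nonneg (ha : 0 < a) (hr : ∀ j, 0 < r j) :
    0 ≤ ∑ j, r j / (a + ∑ l, r l) := by
  have hs : 0 ≤ ∑ l, r l := Finset.sum_nonneg fun l _ => (hr l).le
  exact Finset.sum_nonneg fun j _ => div_nonneg (hr j).le (by linarith)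

/-- The factorization behind both jump series. -/
theorem one_sub_gcpExponent_div (ha : 0 < a) (hr : ∀ j, 0 < r j) (u : ℝ) :
    1 - gcpExponent r u / a = (((a + ∑ l, r l) / a : ℝ) : ℂ) *
      (1 - ∑ j, ((r j / (a + ∑ l, r l) : ℝ) : ℂ) * Complex.exp (Complex.I * u) ^ ((j : ℕ) + 1)) := by
  have hs : 0 ≤ ∑ l, r l := Finset.sum_nonneg fun l _ => (hr l).le
  have hd : ((a + ∑ l, r l : ℝ) : ℂ) ≠ 0 := by
    exact_mod_cast (by linarith : 0 < a + ∑ l, r l).ne'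
  have ha' : (a : ℂ) ≠ 0 := by exact_mod_cast ha.ne'
  have h1 : ∑ j, ((r j / (a + ∑ l, r l) : ℝ) : ℂ) * Complex.exp (Complex.I * u) ^ ((j : ℕ) + 1) =
      (∑ j, (r j : ℂ) * Complex.exp (Complex.I * u) ^ ((j : ℕ) + 1)) / (a + ∑ l, r l : ℝ) := by
    rw [Finset.sum_div]
    refine Finset.sum_congr rfl fun j _ => ?_
    rw [Complex.ofReal_div]
    ring
  rw [h1, gcpExponent]
  simp only [mul_sub, mul_one, Finset.sum_sub_distrib]
  rw [Complex.ofReal_div]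
  field_simp
  push_cast
  ring

theorem jumpWeight_eq (f : Fin k → ℕ) :
    jumpWeight a r f = ∏ j, (r j / (a + ∑ l, r l)) ^ f j / (f j)! := by
  simp only [jumpWeight, mul_one_div]

theorem jumpWeight_nonneg (ha : 0 < a) (hr : ∀ j, 0 < r j) (f : Fin k → ℕ) :
    0 ≤ jumpWeight a r f := by
  have hs : 0 ≤ ∑ l, r l := Finset.sum_nonneg fun l _ => (hr l).le
  refine Finset.prod_nonneg fun j _ => ?_
  have := hr j
  positivity

theorem Gamma_natCast_nonneg (n : ℕ) : 0 ≤ Real.Gamma n := by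
  rcases Nat.eq_zero_or_pos n with rfl | hn
  · simp
  · exact (Real.Gamma_pos_of_pos (by exact_mod_cast hn)).le

/-- Weights `Γ(η)` thus turn the multinomial series into `∑ z^n / n = -log(1 - z)`. At `n = 0` both
sides are `0` by the conventions for `Real.Gamma 0` and division by zero. -/
theorem Gamma_natCast_div_factorial (n : ℕ) : Real.Gamma n / n ! = 1 / n := by
  cases n with
  | zero => simp
  | succ n =>
    have h : ((n ! : ℕ) : ℝ) ≠ 0 := Nat.cast_ne_zero.mpr (Nat.factorial_ne_zero _)
    rw [Nat.cast_succ, Real.Gamma_nat_eq_factorial, Nat.factorial_succ]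
    push_cast
    field_simp

theorem eta_eq_zero_of_mem_omegaSet_zero {f : Fin k → ℕ} (hf : f ∈ omegaSet k 0) :
    eta f = 0 := by
  have h := mem_omegaSet.mp hf
  rw [Finset.sum_eq_zero_iff] at h
  refine Finset.sum_eq_zero fun j hj => ?_
  have := h j hj
  simpa using this

/-- The rate of jumps of size `m + 1` of a gamma-subordinated generalized counting process. -/
def axisTerm (a : ℝ) (r : Fin k → ℝ) (m : ℕ) : ℝ :=
  ∑ f ∈ omegaSet k (m + 1), Real.Gamma (eta f) * jumpWeight a r f

theorem axisTerm_nonneg (ha : 0 < a) (hr : ∀ j, 0 < r j) (m : ℕ) : 0 ≤ axisTerm a r m :=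
  Finset.sum_nonneg fun f _ => mul_nonneg (Gamma_natCast_nonneg _) (jumpWeight_nonneg ha hr f)

theorem hasSum_axisTerm_mul_pow (ha : 0 < a) (hr : ∀ j, 0 < r j) (u : ℝ) :
    HasSum (fun m => (axisTerm a r m : ℂ) * Complex.exp (Complex.I * u) ^ (m + 1))
      (Real.log ((a + ∑ l, r l) / a) - Complex.log (1 - gcpExponent r u / a)) := by
  have hs : 0 ≤ ∑ l, r l := Finset.sum_nonneg fun l _ => (hr l).le
  have hd : 0 < a + ∑ l, r l := by linarith
  have he := norm_exp_I_mul_le u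
  have hz := norm_sum_mul_pow_lt_one ha hr he
  have h1 := hasSum_omegaSet (fun n => Real.Gamma n) Gamma_natCast_nonneg
    (fun j => r j / (a + ∑ l, r l)) (fun j => div_nonneg (hr j).le hd.le) he
    (S := -Complex.log (1 - ∑ j, ((r j / (a + ∑ l, r l) : ℝ) : ℂ)
      * Complex.exp (Complex.I * u) ^ ((j : ℕ) + 1))) ?_ ?_
  · rw [one_sub_gcpExponent_div ha hr, Complex.log_ofReal_mul (by positivity)
      (one_sub_ne_zero_of_norm_lt_one hz)]
    -- The term `n = 0` carries weight `Γ(0) = 0`, so the sum may start at jump size `1`.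
    have h2 := (hasSum_nat_add_iff' 1).mpr h1
    have h0 : ∑ f ∈ omegaSet k 0, Real.Gamma (eta f) *
        ∏ j, (r j / (a + ∑ l, r l)) ^ f j / (f j)! = 0 :=
      Finset.sum_eq_zero fun f hf => by rw [eta_eq_zero_of_mem_omegaSet_zero hf]; simp
    rw [Finset.sum_range_one, h0] at h2
    simp only [Complex.ofReal_zero, zero_mul, sub_zero] at h2
    convert! h2 using 1
    · funext m
      simp only [axisTerm, jumpWeight_eq]
    · ring
  · simp only [Gamma_natCast_div_factorial]
    have h2 := (Complex.hasSum_taylorSeries_neg_log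
      (z := ((∑ j, r j / (a + ∑ l, r l) : ℝ) : ℂ)) (by
        rw [Complex.norm_of_nonneg (sum_div_add_sum_nonneg ha hr)]
        exact sum_div_add_sum_lt_one ha hr)).summable
    have h3 : Summable fun n : ℕ => (∑ j, r j / (a + ∑ l, r l)) ^ n / (n : ℝ) := by
      exact_mod_cast h2
    exact h3.congr fun n => by ring
  · simp only [Gamma_natCast_div_factorial]
    refine (Complex.hasSum_taylorSeries_neg_log hz).congr_fun fun n => ?_
    push_cast
    ring

theorem gcpExponent_zero (r : Fin k → ℝ) : gcpExponent r 0 = 0 := by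
  simp [gcpExponent]

theorem summable_axisTerm (ha : 0 < a) (hr : ∀ j, 0 < r j) : Summable (axisTerm a r) := by
  have h := (hasSum_axisTerm_mul_pow ha hr 0).summable
  simp only [Complex.ofReal_zero, mul_zero, Complex.exp_zero, one_pow, mul_one] at h
  exact_mod_cast h

/-- Subtracting the series at `u = 0` removes the constant `log((a + ∑ r) / a)`. -/
theorem hasSum_axisTerm (ha : 0 < a) (hr : ∀ j, 0 < r j) (u : ℝ) :
    HasSum (fun m => (axisTerm a r m : ℂ) * (Complex.exp (Complex.I * u) ^ (m + 1) - 1))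
      (-Complex.log (1 - gcpExponent r u / a)) := by
  have h := (hasSum_axisTerm_mul_pow ha hr u).sub (hasSum_axisTerm_mul_pow ha hr 0)
  simp only [Complex.ofReal_zero, mul_zero, Complex.exp_zero, one_pow, mul_one, gcpExponent_zero,
    zero_div, sub_zero, Complex.log_one] at h
  convert! h using 1
  · funext m
    ring
  · ring

/-- The probability that a generalized counting process makes a jump of size `n` over a gamma
distributed time with shape `N`. -/
def clockTerm (a : ℝ) (r : Fin k → ℝ) (N n : ℕ) : ℝ :=
  (a / (a + ∑ l, r l)) ^ N *
    ∑ f ∈ omegaSet k n, (ascPochhammer ℝ (eta f)).eval (N : ℝ) * jumpWeight a r f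

theorem clockTerm_nonneg (ha : 0 < a) (hr : ∀ j, 0 < r j) (N n : ℕ) : 0 ≤ clockTerm a r N n := by
  have hs : 0 ≤ ∑ l, r l := Finset.sum_nonneg fun l _ => (hr l).le
  refine mul_nonneg (by positivity) (Finset.sum_nonneg fun f _ => mul_nonneg
    (ascPochhammer_eval_nonneg N.cast_nonneg _) (jumpWeight_nonneg ha hr f))

theorem exp_neg_mul_log {z : ℂ} (hz : z ≠ 0) (N : ℕ) :
    Complex.exp (-(N * Complex.log z)) = (z ^ N)⁻¹ := by
  rw [Complex.exp_neg, Complex.exp_nat_mul, Complex.exp_log hz]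

/-- The factorization of `1 - ψ / a` leaves `(1 - z)^(-N)`, a negative binomial series in `z`. -/
theorem hasSum_clockTerm_mul_pow (ha : 0 < a) (hr : ∀ j, 0 < r j) (N : ℕ) (u : ℝ) :
    HasSum (fun n => (clockTerm a r N n : ℂ) * Complex.exp (Complex.I * u) ^ n)
      ((1 - gcpExponent r u / a) ^ N)⁻¹ := by
  have hs : 0 ≤ ∑ l, r l := Finset.sum_nonneg fun l _ => (hr l).le
  have hd : 0 < a + ∑ l, r l := by linarith
  have he := norm_exp_I_mul_le u
  have hz := norm_sum_mul_pow_lt_one ha hr he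
  have h1 := (hasSum_omegaSet (fun n => (ascPochhammer ℝ n).eval (N : ℝ))
    (ascPochhammer_eval_nonneg N.cast_nonneg)
    (fun j => r j / (a + ∑ l, r l)) (fun j => div_nonneg (hr j).le hd.le) he
    (summable_negBinomial (sum_div_add_sum_nonneg ha hr) (sum_div_add_sum_lt_one ha hr))
    (hasSum_negBinomial N hz)).mul_left (((a / (a + ∑ l, r l)) ^ N : ℝ) : ℂ)
  rw [Complex.ofReal_natCast, exp_neg_mul_log (one_sub_ne_zero_of_norm_lt_one hz)] at h1
  convert! h1 using 1
  · funext n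
    simp only [clockTerm, jumpWeight_eq]
    rw [← mul_assoc, ← Complex.ofReal_mul]
  · rw [one_sub_gcpExponent_div ha hr, mul_pow, mul_inv, ← Complex.ofReal_pow, ← Complex.ofReal_inv,
      ← inv_pow, inv_div]

theorem one_sub_gcpExponent_div_ne_zero (ha : 0 < a) (hr : ∀ j, 0 < r j) (u : ℝ) :
    1 - gcpExponent r u / a ≠ 0 := by
  have hs : 0 ≤ ∑ l, r l := Finset.sum_nonneg fun l _ => (hr l).le
  rw [one_sub_gcpExponent_div ha hr]
  refine mul_ne_zero ?_ (one_sub_ne_zero_of_norm_lt_one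
    (norm_sum_mul_pow_lt_one ha hr (norm_exp_I_mul_le u)))
  exact_mod_cast (by positivity : 0 < (a + ∑ l, r l) / a).ne'

end Coefficients

/-! ### Purely atomic measures -/

section Atomic

variable {q : ℕ} {ι : Type*}

/-- The measure with mass `c i` at the point `x i`. -/
def atomicMeasure (c : ι → ℝ) (x : ι → EuclideanSpace ℝ (Fin q)) :
    Measure (EuclideanSpace ℝ (Fin q)) :=
  Measure.sum fun i => ENNReal.ofReal (c i) • Measure.dirac (x i)

variable {c : ι → ℝ} {x : ι → EuclideanSpace ℝ (Fin q)}

theorem atomicMeasure_apply {s : Set (EuclideanSpace ℝ (Fin q))} (hs : MeasurableSet s) :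
    atomicMeasure c x s = ∑' i, ENNReal.ofReal (c i) * s.indicator 1 (x i) := by
  rw [atomicMeasure, Measure.sum_apply _ hs]
  simp [Measure.dirac_apply' _ hs]

theorem isFiniteMeasure_atomicMeasure (hc : ∀ i, 0 ≤ c i) (hs : Summable c) :
    IsFiniteMeasure (atomicMeasure c x) := by
  refine ⟨?_⟩
  rw [atomicMeasure_apply MeasurableSet.univ]
  simp only [Set.indicator_univ, Pi.one_apply, mul_one]
  rw [← ENNReal.ofReal_tsum_of_nonneg hc hs]
  exact ENNReal.ofReal_lt_top

theorem atomicMeasure_ball (hx : ∀ i, 1 ≤ ‖x i‖) :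
    atomicMeasure c x {y | ‖y‖ < 1} = 0 := by
  rw [atomicMeasure_apply (measurableSet_lt measurable_norm measurable_const)]
  refine ENNReal.tsum_eq_zero.mpr fun i => ?_
  rw [Set.indicator_of_notMem (by simpa using hx i), mul_zero]

theorem integral_atomicMeasure [Countable ι] (hc : ∀ i, 0 ≤ c i) {f : EuclideanSpace ℝ (Fin q) → ℂ} {S : ℂ}
    (h : HasSum (fun i => (c i : ℂ) * f (x i)) S) : ∫ y, f y ∂atomicMeasure c x = S := by
  rw [atomicMeasure, integral_sum_dirac fun i => ENNReal.ofReal_ne_top]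
  simp only [ENNReal.toReal_ofReal (hc _), Complex.real_smul]
  exact h.tsum_eq

end Atomic

/-! ### Finite jump measures outside the unit ball -/

section FiniteJumps

variable {q : ℕ} {ν : Measure (EuclideanSpace ℝ (Fin q))}

/-- Jumps with integer coordinates have norm at least `1`, so the compensating term never acts and
no drift is needed to offset it. -/
theorem levyExponent_zero_zero (hν : ν {y | ‖y‖ < 1} = 0) (u : EuclideanSpace ℝ (Fin q)) :
    levyExponent 0 0 ν u = ∫ x, (Complex.exp (Complex.I * (inner ℝ x u : ℝ)) - 1) ∂ν := by
  have h : ∀ᵐ x ∂ν, ¬ ‖x‖ < 1 := by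
    rw [ae_iff]
    simpa using hν
  have h2 : levyExponent 0 0 ν u = ∫ x, levyIntegrand u x ∂ν := by
    simp [levyExponent, levyIntegrand]
  rw [h2]
  refine integral_congr_ae ?_
  filter_upwards [h] with x hx
  rw [levyIntegrand, Set.indicator_of_notMem (by exact hx)]
  simp

theorem isLevyMeasure_of_finite {Ω : Type*} [MeasurableSpace Ω] {P : Measure Ω}
    {X : ℝ≥0 → Ω → EuclideanSpace ℝ (Fin q)} {Ψ : EuclideanSpace ℝ (Fin q) → ℂ}
    [IsFiniteMeasure ν] (hν : ν {y | ‖y‖ < 1} = 0)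
    (hΨ : ∀ u, ∫ x, (Complex.exp (Complex.I * (inner ℝ x u : ℝ)) - 1) ∂ν = Ψ u)
    (hX : IsLevyProcess P X ∧
      ∀ (t : ℝ≥0) u, charFun (P.map (X t)) u = Complex.exp ((t : ℝ) * Ψ u)) :
    IsLevyMeasure P X ν where
  isLevyProcess := hX.1
  zero := measure_mono_null (by simp) hν
  lintegral_lt_top := by
    refine (lintegral_mono (g := fun _ => 1) fun x => ?_).trans_lt (by simp)
    rw [← ENNReal.ofReal_one]
    exact ENNReal.ofReal_le_ofReal (min_le_left _ _)
  charFun_eq := by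
    refine ⟨0, 0, Matrix.PosSemidef.zero, fun t u => ?_⟩
    rw [hX.2, levyExponent_zero_zero hν, hΨ]

theorem indicator_box (A : Fin q → Set ℝ) (x : EuclideanSpace ℝ (Fin q)) :
    (box A).indicator (1 : EuclideanSpace ℝ (Fin q) → ℝ≥0∞) x =
      ∏ i, (A i).indicator 1 (x i) := by
  by_cases h : x ∈ box A
  · rw [Set.indicator_of_mem h, Finset.prod_eq_one fun i _ => Set.indicator_of_mem (h i) _]
    rfl
  · obtain ⟨i, hi⟩ : ∃ i, x i ∉ A i := by simpa [box] using h
    rw [Set.indicator_of_notMem h, Finset.prod_eq_zero (Finset.mem_univ i)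
      (Set.indicator_of_notMem hi _)]

theorem measurableSet_box {A : Fin q → Set ℝ} (hA : ∀ i, MeasurableSet (A i)) :
    MeasurableSet (box A) := by
  have : box A = ⋂ i, (fun x : EuclideanSpace ℝ (Fin q) => x i) ⁻¹' A i := by
    ext x
    simp [box]
  rw [this]
  exact MeasurableSet.iInter fun i => (by fun_prop :
    Measurable fun x : EuclideanSpace ℝ (Fin q) => x i) (hA i)

end FiniteJumps

/-! ### The axis and clock measures: masses of boxes and exponents -/

section LevyMeasures

variable {q : ℕ} {lam : ℝ≥0} {θ : ℝ} {k : Fin q → ℕ} {r : (i : Fin q) → Fin (k i) → ℝ}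
  {a : Fin q → ℝ}

/-- The Lévy measure of independent gamma-subordinated generalized counting processes: it is
concentrated on the coordinate axes. -/
def axisMeasure (lam : ℝ≥0) (r : (i : Fin q) → Fin (k i) → ℝ) (a : Fin q → ℝ) :
    Measure (EuclideanSpace ℝ (Fin q)) :=
  ∑ i, atomicMeasure (fun m : ℕ => lam * axisTerm (a i) (r i) m)
    fun m => EuclideanSpace.single i ((m + 1 : ℕ) : ℝ)

/-- The point of `ℝ^q` with coordinates in `ℕ`. -/
def natPoint (n : Fin q → ℕ) : EuclideanSpace ℝ (Fin q) := WithLp.toLp 2 fun i => (n i : ℝ)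

/-- The rate of jumps by `n` at those jumps of the negative binomial clock that have size `l + 1`. -/
def clockWeight (lam : ℝ≥0) (θ : ℝ) (r : (i : Fin q) → Fin (k i) → ℝ) (a : Fin q → ℝ)
    (l : ℕ) (n : Fin q → ℕ) : ℝ :=
  lam * (θ ^ (l + 1) / ((l + 1 : ℕ) : ℝ) * ∏ i, clockTerm (a i) (r i) (l + 1) (n i))

/-- The Lévy measure of the jumps of the negative binomial clock. -/
def clockMeasure (lam : ℝ≥0) (θ : ℝ) (r : (i : Fin q) → Fin (k i) → ℝ) (a : Fin q → ℝ) :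
    Measure (EuclideanSpace ℝ (Fin q)) :=
  atomicMeasure (fun p : ℕ × {n : Fin q → ℕ // n ≠ 0} => clockWeight lam θ r a p.1 p.2.1)
    fun p => natPoint p.2.1

theorem isFiniteMeasure_axisMeasure (ha : ∀ i, 0 < a i) (hr : ∀ i j, 0 < r i j) :
    IsFiniteMeasure (axisMeasure lam r a) := by
  have : ∀ i, IsFiniteMeasure (atomicMeasure (fun m : ℕ => lam * axisTerm (a i) (r i) m)
      fun m => EuclideanSpace.single i ((m + 1 : ℕ) : ℝ)) := fun i =>
    isFiniteMeasure_atomicMeasure (fun m => mul_nonneg lam.2 (axisTerm_nonneg (ha i) (hr i) m))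
      ((summable_axisTerm (ha i) (hr i)).mul_left _)
  unfold axisMeasure
  infer_instance

theorem axisMeasure_ball : axisMeasure lam r a {y | ‖y‖ < 1} = 0 := by
  rw [axisMeasure, Measure.finsetSum_apply]
  refine Finset.sum_eq_zero fun i _ => atomicMeasure_ball fun m => ?_
  rw [PiLp.norm_single, Real.norm_of_nonneg (Nat.cast_nonneg _)]
  push_cast
  linarith [(Nat.cast_nonneg m : (0 : ℝ) ≤ m)]

theorem axisMeasure_box {A : Fin q → Set ℝ} (hA : ∀ i, MeasurableSet (A i)) :
    axisMeasure lam r a (box A) = axisPart lam k r a A := by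
  rw [axisMeasure, Measure.finsetSum_apply, axisPart]
  refine Finset.sum_congr rfl fun i _ => ?_
  rw [atomicMeasure_apply (measurableSet_box hA)]
  refine tsum_congr fun m => ?_
  rw [axisTerm, indicator_box, ← Finset.mul_prod_erase _ _ (Finset.mem_univ i)]
  congr 2
  · simp
  · refine Finset.prod_congr rfl fun j hj => ?_
    have : j ≠ i := Finset.ne_of_mem_erase hj
    simp [this]

theorem integral_axisMeasure (ha : ∀ i, 0 < a i) (hr : ∀ i j, 0 < r i j)
    (u : EuclideanSpace ℝ (Fin q)) :
    ∫ x, (Complex.exp (Complex.I * (inner ℝ x u : ℝ)) - 1) ∂axisMeasure lam r a =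
      gammaExponent lam a fun i => gcpExponent (r i) (u i) := by
  have hfin := isFiniteMeasure_axisMeasure (lam := lam) ha hr
  have hint : Integrable (fun x : EuclideanSpace ℝ (Fin q) =>
      Complex.exp (Complex.I * (inner ℝ x u : ℝ)) - 1) (axisMeasure lam r a) :=
    Integrable.of_bound (by fun_prop) (1 + 1) (ae_of_all _ fun x =>
      (norm_sub_le _ _).trans (add_le_add (norm_exp_I_mul_le _) (by simp)))
  rw [axisMeasure, integrable_finsetSum_measure] at hint
  rw [axisMeasure, integral_finsetSum_measure hint, gammaExponent, Finset.mul_sum,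
    ← Finset.sum_neg_distrib]
  refine Finset.sum_congr rfl fun i _ => ?_
  refine integral_atomicMeasure
    (fun m => mul_nonneg lam.2 (axisTerm_nonneg (ha i) (hr i) m)) ?_
  have h := (hasSum_axisTerm (ha i) (hr i) (u i)).mul_left ((lam : ℝ) : ℂ)
  rw [mul_neg] at h
  refine h.congr_fun fun m => ?_
  rw [EuclideanSpace.inner_single_left, ← Complex.exp_nat_mul]
  push_cast
  rw [mul_assoc]
  congr 4
  simp
  ring

theorem clockWeight_nonneg (hθ0 : 0 < θ) (ha : ∀ i, 0 < a i) (hr : ∀ i j, 0 < r i j) (l : ℕ)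
    (n : Fin q → ℕ) : 0 ≤ clockWeight lam θ r a l n := by
  have : 0 ≤ ∏ i, clockTerm (a i) (r i) (l + 1) (n i) :=
    Finset.prod_nonneg fun i _ => clockTerm_nonneg (ha i) (hr i) _ _
  unfold clockWeight
  positivity

theorem exp_inner_natPoint (n : Fin q → ℕ) (u : EuclideanSpace ℝ (Fin q)) :
    Complex.exp (Complex.I * (inner ℝ (natPoint n) u : ℝ)) =
      ∏ i, Complex.exp (Complex.I * u i) ^ n i := by
  simp only [natPoint, PiLp.inner_apply, ← Complex.exp_nat_mul]
  rw [← Complex.exp_sum]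
  congr 1
  push_cast
  rw [Finset.mul_sum]
  refine Finset.sum_congr rfl fun i _ => ?_
  simp
  ring

/-- Dividing by `λ` leaves integer multiples of logarithms, whose exponentials are honest powers
independent of any branch. -/
theorem exp_gammaExponent_div_pow (hlam : 0 < lam) (ha : ∀ i, 0 < a i) (hr : ∀ i j, 0 < r i j)
    (u : EuclideanSpace ℝ (Fin q)) (N : ℕ) :
    Complex.exp (gammaExponent lam a (fun i => gcpExponent (r i) (u i)) / (lam : ℝ)) ^ N =
      ∏ i, ((1 - gcpExponent (r i) (u i) / a i) ^ N)⁻¹ := by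
  have hlam' : ((lam : ℝ) : ℂ) ≠ 0 := by exact_mod_cast hlam.ne'
  rw [← Complex.exp_nat_mul, gammaExponent, neg_div, mul_div_cancel_left₀ _ hlam', mul_neg,
    Finset.mul_sum, ← Finset.sum_neg_distrib, Complex.exp_sum]
  exact Finset.prod_congr rfl fun i _ =>
    exp_neg_mul_log (one_sub_gcpExponent_div_ne_zero (ha i) (hr i) _) N

/-- The sum includes `n = 0`, which lets it factor over the coordinates. -/
theorem hasSum_clockWeight_mul_exp (hlam : 0 < lam) (ha : ∀ i, 0 < a i) (hr : ∀ i j, 0 < r i j)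
    (u : EuclideanSpace ℝ (Fin q)) (l : ℕ) :
    HasSum (fun n => (clockWeight lam θ r a l n : ℂ)
        * Complex.exp (Complex.I * (inner ℝ (natPoint n) u : ℝ)))
      ((lam : ℝ) * ((θ * Complex.exp
        (gammaExponent lam a (fun i => gcpExponent (r i) (u i)) / (lam : ℝ))) ^ (l + 1)
          / ((l : ℂ) + 1))) := by
  have h := (hasSum_pi_prod fun i =>
    hasSum_clockTerm_mul_pow (ha i) (hr i) (l + 1) (u i)).mul_left
      (((lam * (θ ^ (l + 1) / ((l + 1 : ℕ) : ℝ)) : ℝ)) : ℂ)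
  rw [← exp_gammaExponent_div_pow hlam ha hr] at h
  convert! h using 1
  · funext n
    rw [exp_inner_natPoint, Finset.prod_mul_distrib, clockWeight]
    push_cast
    ring
  · rw [mul_pow]
    push_cast
    ring

theorem gammaExponent_zero : gammaExponent lam a (fun i => gcpExponent (r i) 0) = 0 := by
  simp [gammaExponent, gcpExponent_zero]

theorem hasSum_clockWeight (hlam : 0 < lam) (ha : ∀ i, 0 < a i) (hr : ∀ i j, 0 < r i j) (l : ℕ) :
    HasSum (fun n => (clockWeight lam θ r a l n : ℂ))
      ((lam : ℝ) * ((θ : ℂ) ^ (l + 1) / ((l : ℂ) + 1))) := by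
  have h := hasSum_clockWeight_mul_exp (θ := θ) hlam ha hr 0 l
  simpa [gammaExponent_zero] using h

theorem summable_clockWeight (hlam : 0 < lam) (hθ0 : 0 < θ) (hθ1 : θ < 1) (ha : ∀ i, 0 < a i)
    (hr : ∀ i j, 0 < r i j) :
    Summable fun p : ℕ × {n : Fin q → ℕ // n ≠ 0} => clockWeight lam θ r a p.1 p.2.1 := by
  have h1 : ∀ l, HasSum (fun n => clockWeight lam θ r a l n)
      ((lam : ℝ) * (θ ^ (l + 1) / ((l : ℝ) + 1))) := fun l => by
    have := hasSum_clockWeight (θ := θ) hlam ha hr l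
    exact_mod_cast this
  have h2 : Summable fun l : ℕ => (lam : ℝ) * (θ ^ (l + 1) / ((l : ℝ) + 1)) := by
    have := (Complex.hasSum_taylorSeries_neg_log' (z := (θ : ℂ)) (by
      rwa [Complex.norm_of_nonneg hθ0.le])).summable
    have h3 : Summable fun l : ℕ => θ ^ (l + 1) / ((l : ℝ) + 1) := by exact_mod_cast this
    exact h3.mul_left _
  have h3 : Summable fun p : ℕ × (Fin q → ℕ) => clockWeight lam θ r a p.1 p.2 := by
    rw [summable_prod_of_nonneg fun p => clockWeight_nonneg hθ0 ha hr _ _]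
    exact ⟨fun l => (h1 l).summable, h2.congr fun l => ((h1 l).tsum_eq).symm⟩
  exact h3.comp_injective (i := Prod.map id Subtype.val)
    (Function.injective_id.prodMap Subtype.val_injective)

theorem isFiniteMeasure_clockMeasure (hlam : 0 < lam) (hθ0 : 0 < θ) (hθ1 : θ < 1)
    (ha : ∀ i, 0 < a i) (hr : ∀ i j, 0 < r i j) : IsFiniteMeasure (clockMeasure lam θ r a) :=
  isFiniteMeasure_atomicMeasure (fun _ => clockWeight_nonneg hθ0 ha hr _ _)
    (summable_clockWeight hlam hθ0 hθ1 ha hr)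

theorem clockMeasure_ball : clockMeasure lam θ r a {y | ‖y‖ < 1} = 0 := by
  refine atomicMeasure_ball fun p => ?_
  obtain ⟨i, hi⟩ : ∃ i, p.2.1 i ≠ 0 := Function.ne_iff.mp p.2.2
  refine le_trans ?_ (PiLp.norm_apply_le (natPoint p.2.1) i)
  have h1 : (1 : ℝ) ≤ (p.2.1 i : ℝ) := by exact_mod_cast Nat.one_le_iff_ne_zero.mpr hi
  have h2 : natPoint p.2.1 i = (p.2.1 i : ℝ) := rfl
  rwa [h2, Real.norm_of_nonneg (by linarith)]

theorem clockMeasure_box {A : Fin q → Set ℝ} (hA : ∀ i, MeasurableSet (A i)) :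
    clockMeasure lam θ r a (box A) = clockPart lam θ k r a A := by
  rw [clockMeasure, atomicMeasure_apply (measurableSet_box hA), ENNReal.tsum_prod',
    ENNReal.tsum_comm, clockPart]
  refine tsum_congr fun n => tsum_congr fun l => ?_
  rw [indicator_box]
  rfl

/-- Summing over `n` first gives `λ ((θ x)^l - θ^l) / l` with `x = exp(γ / λ)`; summing over `l ≥ 1`
gives the difference of two logarithms. -/
theorem integral_clockMeasure (hlam : 0 < lam) (hθ0 : 0 < θ) (hθ1 : θ < 1) (ha : ∀ i, 0 < a i)
    (hr : ∀ i j, 0 < r i j) (u : EuclideanSpace ℝ (Fin q)) :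
    ∫ x, (Complex.exp (Complex.I * (inner ℝ x u : ℝ)) - 1) ∂clockMeasure lam θ r a =
      (lam : ℝ) * negBinExponent θ (Complex.exp
        (gammaExponent lam a (fun i => gcpExponent (r i) (u i)) / (lam : ℝ))) := by
  refine integral_atomicMeasure (fun _ => clockWeight_nonneg hθ0 ha hr _ _) ?_
  set x := Complex.exp (gammaExponent lam a (fun i => gcpExponent (r i) (u i)) / (lam : ℝ)) with hx
  have hx1 : ‖x‖ ≤ 1 := norm_exp_div_le_one
    (gammaExponent_re_nonpos ha fun i => gcpExponent_re_nonpos (hr i) _) lam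
  have hsum : Summable fun p : ℕ × {n : Fin q → ℕ // n ≠ 0} =>
      (clockWeight lam θ r a p.1 p.2.1 : ℂ)
        * (Complex.exp (Complex.I * (inner ℝ (natPoint p.2.1) u : ℝ)) - 1) := by
    refine Summable.of_norm_bounded
      ((summable_clockWeight hlam hθ0 hθ1 ha hr).mul_right (1 + 1)) fun p => ?_
    rw [norm_mul, Complex.norm_of_nonneg (clockWeight_nonneg hθ0 ha hr _ _)]
    exact mul_le_mul_of_nonneg_left
      ((norm_sub_le _ _).trans (add_le_add (norm_exp_I_mul_le _) (by simp)))
      (clockWeight_nonneg hθ0 ha hr _ _)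
  have hl : ∀ l : ℕ, HasSum (fun n : {n : Fin q → ℕ // n ≠ 0} =>
      (clockWeight lam θ r a l n.1 : ℂ)
        * (Complex.exp (Complex.I * (inner ℝ (natPoint n.1) u : ℝ)) - 1))
      ((lam : ℝ) * ((θ * x) ^ (l + 1) / ((l : ℂ) + 1) - (θ : ℂ) ^ (l + 1) / ((l : ℂ) + 1))) := by
    intro l
    have h := (hasSum_clockWeight_mul_exp (θ := θ) hlam ha hr u l).sub
      (hasSum_clockWeight (θ := θ) hlam ha hr l)
    rw [← mul_sub] at h
    have h2 : HasSum (fun n => (clockWeight lam θ r a l n : ℂ)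
        * (Complex.exp (Complex.I * (inner ℝ (natPoint n) u : ℝ)) - 1)) _ :=
      h.congr_fun fun n => by ring
    -- The point `n = 0` may be dropped because the factor `exp(i⟨0, u⟩) - 1` vanishes there.
    refine (hasSum_subtype_iff_of_support_subset (s := {n | n ≠ 0}) ?_).mpr h2
    intro n hn h0
    subst h0
    refine hn ?_
    have : natPoint (0 : Fin q → ℕ) = 0 := by
      ext i
      simp [natPoint]
    simp [this]
  have hlog := ((Complex.hasSum_taylorSeries_neg_log' (norm_ofReal_mul_lt_one hθ0 hθ1 hx1)).sub
    (Complex.hasSum_taylorSeries_neg_log' (z := (θ : ℂ)) (by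
      rwa [Complex.norm_of_nonneg hθ0.le]))).mul_left ((lam : ℝ) : ℂ)
  have htot := (hsum.hasSum.prod_fiberwise hl).unique hlog
  have hval : ((lam : ℝ) : ℂ) * (-Complex.log (1 - θ * x) - -Complex.log (1 - θ)) =
      (lam : ℝ) * negBinExponent θ x := by
    rw [negBinExponent, Complex.ofReal_log (by linarith)]
    push_cast
    ring
  rw [← hval, ← htot]
  exact hsum.hasSum

end LevyMeasures

end
-- The theorem
theorem mainTheorem4 {Ω : Type*} [MeasurableSpace Ω] (P : Measure Ω) [IsProbabilityMeasure P]
    {q : ℕ} (lam : ℝ≥0) (hlam : 0 < lam) (θ : ℝ) (hθ0 : 0 < θ) (hθ1 : θ < 1)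
    (a : Fin q → ℝ) (ha : ∀ i, 0 < a i)
    (k : Fin q → ℕ) (r : (i : Fin q) → Fin (k i) → ℝ) (hr : ∀ i j, 0 < r i j)
    (M : Fin q → ℝ≥0 → Ω → ℕ) (Z : Fin q → ℝ≥0 → Ω → ℝ≥0) (B : ℝ≥0 → Ω → ℕ)
    (hM : ∀ i, IsGCP P (r i) (M i))
    (hZ : ∀ i, IsGammaProcess P lam (a i) (Z i))
    (hB : IsNegBinProcess P θ B)
    (hMindep : iIndepFun (fun i ω t => M i t ω) P)
    (hZindep : iIndepFun (fun i ω t => Z i t ω) P)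
    (hZB : IndepFun (fun ω i t => Z i t ω) (fun ω t => B t ω) P)
    (hMZ : IndepFun (fun ω i t => M i t ω) (fun ω i t => Z i t ω) P)
    (hMG : IndepFun (fun ω i t => M i t ω) (fun ω i t => gammaSubordinator lam Z B i t ω) P) :
    ∃ ν₀ ν : Measure (EuclideanSpace ℝ (Fin q)),
      (∀ ρ, IsLevyMeasure P (timeChange M Z) ρ ↔ ρ = ν₀) ∧
      (∀ ρ, IsLevyMeasure P (timeChange M (gammaSubordinator lam Z B)) ρ ↔ ρ = ν) ∧
      ∀ A : Fin q → Set ℝ, (∀ i, MeasurableSet (A i)) →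
        ν₀ (box A) = axisPart lam k r a A ∧
        ν (box A) = axisPart lam k r a A + clockPart lam θ k r a A := by
  have hTZ := isJointSubordinator_gamma hlam ha hZ hZindep
  have hTG := isJointSubordinator_gammaSubordinator hlam hθ0 hθ1 ha hZ hB hZindep hZB
  have hfin₀ := isFiniteMeasure_axisMeasure (lam := lam) ha hr
  have hfin₁ := isFiniteMeasure_clockMeasure hlam hθ0 hθ1 ha hr
  have h₀ : IsLevyMeasure P (timeChange M Z) (axisMeasure lam r a) :=
    isLevyMeasure_of_finite axisMeasure_ball (integral_axisMeasure ha hr)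
      (isLevy_timeChange hr hM hMindep hTZ hMZ)
  have h₁ : IsLevyMeasure P (timeChange M (gammaSubordinator lam Z B))
      (axisMeasure lam r a + clockMeasure lam θ r a) := by
    refine isLevyMeasure_of_finite ?_ (fun u => ?_)
      (isLevy_timeChange hr hM hMindep hTG hMG)
    · rw [Measure.add_apply, axisMeasure_ball, clockMeasure_ball, add_zero]
    · have hint : ∀ ρ : Measure (EuclideanSpace ℝ (Fin q)), IsFiniteMeasure ρ →
          Integrable (fun x : EuclideanSpace ℝ (Fin q) =>
            Complex.exp (Complex.I * (inner ℝ x u : ℝ)) - 1) ρ := fun ρ _ =>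
        Integrable.of_bound (by fun_prop) (1 + 1) (ae_of_all _ fun x =>
          (norm_sub_le _ _).trans (add_le_add (norm_exp_I_mul_le _) (by simp)))
      rw [integral_add_measure (hint _ hfin₀) (hint _ hfin₁), integral_axisMeasure ha hr,
        integral_clockMeasure hlam hθ0 hθ1 ha hr]
      -- `clockExponent` is by definition the sum of the exponents of the two measures.
      rfl
  refine ⟨axisMeasure lam r a, axisMeasure lam r a + clockMeasure lam θ r a,
    fun ρ => ⟨fun h => h.unique h₀, fun h => h ▸ h₀⟩,
    fun ρ => ⟨fun h => h.unique h₁, fun h => h ▸ h₁⟩, fun A hA => ?_⟩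
  rw [Measure.add_apply, axisMeasure_box hA, clockMeasure_box hA]
  exact ⟨rfl, rfl⟩
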